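/- Let $K$ be a field and let $A$ be a finite-dimensional $K$-algebra. Modules are finite-dimensional right $A$-modules unless stated otherwise, and $D=\operatorname{Hom}_K(-,K)$ is the duality between right and left $A$-modules. The dominant dimension of a (right or left) module $M$ with minimal injective resolution $0\to M\to I_0\to I_1\to\cdots$ is the supremum in $\{0,1,2,\dots,\infty\}$ of all $n\ge 0$ such that $I_0,\dots,I_{n-1}$ are projective; the codominant dimension of a right module $M$ is the dominant dimension of the left module $D(M)$. The module $M$ is called Gorenstein projective if $\operatorname{Ext}^i_A(M,A)=0=\operatorname{Ext}^i_A(\operatorname{Tr}(M),A)$ for all $i\ge 1$, where $\operatorname{Tr}(M)$ is the cokernel of $\operatorname{Hom}_A(P_0,A)\to\operatorname{Hom}_A(P_1,A)$ for a minimal projective presentation $P_1\to P_0\to M\to 0$, and similarly for left modules; a right module $M$ is called Gorenstein injective if the left module $D(M)$ is Gorenstein projective, and Gorenstein projective-injective if it is both Gorenstein projective and Gorenstein injective. Assume that $A$ is gendo-symmetric, that is, the right module $A_A$ has dominant dimension at least $2$ and there is an idempotent $e\in A$ such that $eA$ is a minimal faithful projective-injective right $A$-module (faithful, projective, injective, and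 a direct summand of every faithful right $A$-module) and $D(Ae)\cong eA$ as $(eAe,A)$-bimodules. Then for every finite-dimensional right $A$-module $M$ the following are equivalent: 1. $M$ is Gorenstein projective-injective. 2. $M$ has infinite dominant dimension and infinite codominant dimension. -/

import Mathlib

open MulOpposite CategoryTheory

universe u

/-! Modules over a ring `R` are left `R`-modules; right `A`-modules are `Aᵐᵒᵖ`-modules. -/

/-- A minimal injective resolution `0 → M → I 0 → I 1 → ⋯`: an exact sequence with injective terms
in which the image of each map is an essential submodule of its target. -/
structure MinimalInjectiveResolution (R : Type u) [Ring R] (M : Type u) [AddCommGroup M]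
    [Module R M] where
  I : ℕ → Type u
  [addCommGroup : ∀ n, AddCommGroup (I n)]
  [module : ∀ n, Module R (I n)]
  injective : ∀ n, Module.Injective R (I n)
  ι : M →ₗ[R] I 0
  d : ∀ n, I n →ₗ[R] I (n + 1)
  ι_injective : Function.Injective ι
  exact_zero : Function.Exact ι (d 0)
  exact_succ : ∀ n, Function.Exact (d n) (d (n + 1))
  essential_zero : ∀ N : Submodule R (I 0), N ⊓ LinearMap.range ι = ⊥ → N = ⊥
  essential_succ : ∀ n, ∀ N : Submodule R (I (n + 1)), N ⊓ LinearMap.range (d n) = ⊥ → N = ⊥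

attribute [instance] MinimalInjectiveResolution.addCommGroup MinimalInjectiveResolution.module

/-- The dominant dimension of `M`: the supremum of all `n` such that the terms `I 0, …, I (n - 1)`
of a minimal injective resolution of `M` are projective. (Minimal injective resolutions exist and
are unique up to isomorphism.) -/
noncomputable def dominantDimension (R : Type u) [Ring R] (M : Type u) [AddCommGroup M]
    [Module R M] : ℕ∞ :=
  sSup {k : ℕ∞ | ∃ n : ℕ, k = n ∧
    ∃ J : MinimalInjectiveResolution R M, ∀ i < n, Module.Projective R (J.I i)}

/-- The `K`-dual `D(M) = Hom_K(M, K)` of a right `A`-module `M`. -/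
def KDual (K A M : Type u) [Field K] [Ring A] [Algebra K A] [AddCommGroup M] [Module K M]
    [Module Aᵐᵒᵖ M] [IsScalarTower K Aᵐᵒᵖ M] : Type u :=
  M →ₗ[K] K

section KDual

variable (K A M : Type u) [Field K] [Ring A] [Algebra K A] [AddCommGroup M] [Module K M]
  [Module Aᵐᵒᵖ M] [IsScalarTower K Aᵐᵒᵖ M]

instance : AddCommGroup (KDual K A M) :=
  inferInstanceAs (AddCommGroup (M →ₗ[K] K))

/-- `D(M)` is a left `A`-module through `(a f)(m) = f(m a)`. -/
instance : Module A (KDual K A M) where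
  smul a f := LinearMap.comp (show M →ₗ[K] K from f) (Algebra.lsmul K K M (op a))
  one_smul f := LinearMap.ext fun m => congrArg (show M →ₗ[K] K from f) (one_smul Aᵐᵒᵖ m)
  mul_smul a b f := LinearMap.ext fun m =>
    congrArg (show M →ₗ[K] K from f) (mul_smul (op b) (op a) m)
  smul_zero _ := LinearMap.ext fun _ => rfl
  smul_add _ _ _ := LinearMap.ext fun _ => rfl
  add_smul a b f := LinearMap.ext fun m =>
    (congrArg (show M →ₗ[K] K from f) (add_smul (op a) (op b) m)).trans (map_add _ _ _)
  zero_smul f := LinearMap.ext fun m =>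
    (congrArg (show M →ₗ[K] K from f) (zero_smul Aᵐᵒᵖ m)).trans (map_zero _)

end KDual

/-- The codominant dimension of a right `A`-module `M`: the dominant dimension of `D(M)`. -/
noncomputable def codominantDimension (K A M : Type u) [Field K] [Ring A] [Algebra K A]
    [AddCommGroup M] [Module K M] [Module Aᵐᵒᵖ M] [IsScalarTower K Aᵐᵒᵖ M] : ℕ∞ :=
  dominantDimension A (KDual K A M)

/-- A minimal projective presentation `P₁ → P₀ → M → 0`: an exact sequence in which `P₀ → M` and
`P₁ → ker (P₀ → M)` are projective covers, i.e. surjections from projective modules whose kernels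
are superfluous. -/
structure MinimalProjectivePresentation (R : Type u) [Ring R] (M : Type u) [AddCommGroup M]
    [Module R M] where
  P₀ : Type u
  P₁ : Type u
  [addCommGroup₀ : AddCommGroup P₀]
  [addCommGroup₁ : AddCommGroup P₁]
  [module₀ : Module R P₀]
  [module₁ : Module R P₁]
  projective₀ : Module.Projective R P₀
  projective₁ : Module.Projective R P₁
  π : P₀ →ₗ[R] M
  d : P₁ →ₗ[R] P₀
  π_surjective : Function.Surjective π
  exact : Function.Exact d π
  superfluous₀ : ∀ N : Submodule R P₀, N ⊔ LinearMap.ker π = ⊤ → N = ⊤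
  superfluous₁ : ∀ N : Submodule R P₁, N ⊔ LinearMap.ker d = ⊤ → N = ⊤

attribute [instance] MinimalProjectivePresentation.addCommGroup₀
  MinimalProjectivePresentation.addCommGroup₁ MinimalProjectivePresentation.module₀
  MinimalProjectivePresentation.module₁

section Transpose

variable {R : Type u} (S T : Type u) [Ring R] [Ring S] [AddCommGroup T] [Module R T] [Module S T]
  [SMulCommClass R S T] {M : Type u} [AddCommGroup M] [Module R M]

/-- For `d : P₁ → P₀`, the map `Hom_R(d, T) : Hom_R(P₀, T) → Hom_R(P₁, T)`, `φ ↦ φ ∘ d`, which is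
`S`-linear for the action of `S` on `T`. -/
def MinimalProjectivePresentation.dualMap (X : MinimalProjectivePresentation R M) :
    (X.P₀ →ₗ[R] T) →ₗ[S] (X.P₁ →ₗ[R] T) where
  toFun φ := φ ∘ₗ X.d
  map_add' _ _ := rfl
  map_smul' _ _ := rfl

/-- The transpose `Tr(M)`, the cokernel of `Hom_R(P₀, T) → Hom_R(P₁, T)`, computed from a minimal
projective presentation of `M`. Here `T` is the regular bimodule of an algebra `A`, and either
`R = Aᵐᵒᵖ`, `S = A` (for right modules `M`) or `R = A`, `S = Aᵐᵒᵖ` (for left modules `M`). -/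
abbrev MinimalProjectivePresentation.Transpose (X : MinimalProjectivePresentation R M) : Type u :=
  (X.P₁ →ₗ[R] T) ⧸ LinearMap.range (X.dualMap S T)

end Transpose

/-- `Ext_R^i(M, N) = 0` for all `i ≥ 1`. -/
def ExtVanishes (R M N : Type u) [Ring R] [AddCommGroup M] [Module R M] [AddCommGroup N]
    [Module R N] : Prop :=
  ∀ i : ℕ, 1 ≤ i → Subsingleton (Abelian.Ext.{u} (ModuleCat.of R M) (ModuleCat.of R N) i)

/-- A right `A`-module `M` is Gorenstein projective if `Ext^i(M, A) = 0 = Ext^i(Tr(M), A)` for all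
`i ≥ 1`, where `Tr(M)` is a left `A`-module. -/
def IsGorensteinProjective (A M : Type u) [Ring A] [AddCommGroup M] [Module Aᵐᵒᵖ M] : Prop :=
  ExtVanishes Aᵐᵒᵖ M A ∧
    ∃ X : MinimalProjectivePresentation Aᵐᵒᵖ M, ExtVanishes A (X.Transpose A A) A

/-- The same notion for a left `A`-module `M`; now `Tr(M)` is a right `A`-module. -/
def IsLeftGorensteinProjective (A M : Type u) [Ring A] [AddCommGroup M] [Module A M] : Prop :=
  ExtVanishes A M A ∧
    ∃ X : MinimalProjectivePresentation A M, ExtVanishes Aᵐᵒᵖ (X.Transpose Aᵐᵒᵖ A) A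

/-- A right `A`-module `M` is Gorenstein injective if the left `A`-module `D(M)` is Gorenstein
projective. -/
def IsGorensteinInjective (K A M : Type u) [Field K] [Ring A] [Algebra K A]
    [AddCommGroup M] [Module K M] [Module Aᵐᵒᵖ M] [IsScalarTower K Aᵐᵒᵖ M] : Prop :=
  IsLeftGorensteinProjective A (KDual K A M)

/-- A right `A`-module is Gorenstein projective-injective if it is Gorenstein projective and
Gorenstein injective. -/
def IsGorensteinProjectiveInjective (K A M : Type u) [Field K] [Ring A] [Algebra K A]
    [AddCommGroup M] [Module K M] [Module Aᵐᵒᵖ M] [IsScalarTower K Aᵐᵒᵖ M] : Prop :=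
  IsGorensteinProjective A M ∧ IsGorensteinInjective K A M

section GendoSymmetric

/-- The left ideal `A e`. -/
abbrev leftIdeal {A : Type u} [Ring A] (e : A) : Submodule A A :=
  Submodule.span A {e}

/-- The right ideal `e A`. -/
abbrev rightIdeal {A : Type u} [Ring A] (e : A) : Submodule Aᵐᵒᵖ A :=
  Submodule.span Aᵐᵒᵖ {e}

/-- `e` is an idempotent such that `e A` is a minimal faithful projective-injective right
`A`-module: it is faithful, projective and injective, and a direct summand of every finitely
generated faithful right `A`-module. -/
structure IsMinimalFaithfulProjInj {A : Type u} [Ring A] (e : A) : Prop where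
  idempotent : IsIdempotentElem e
  projective : Module.Projective Aᵐᵒᵖ (rightIdeal e)
  injective : Module.Injective Aᵐᵒᵖ (rightIdeal e)
  faithful : FaithfulSMul Aᵐᵒᵖ (rightIdeal e)
  minimal : ∀ (N : Type u) [AddCommGroup N] [Module Aᵐᵒᵖ N] [Module.Finite Aᵐᵒᵖ N]
    [FaithfulSMul Aᵐᵒᵖ N], ∃ (i : rightIdeal e →ₗ[Aᵐᵒᵖ] N) (p : N →ₗ[Aᵐᵒᵖ] rightIdeal e),
      p ∘ₗ i = LinearMap.id

variable (K : Type u) {A : Type u} [Field K] [Ring A] [Algebra K A]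

/-- Right multiplication `A e → A e`, `x ↦ x (e a e)` by an element of `e A e`. -/
def mulRightCorner (e a : A) : leftIdeal e →ₗ[K] leftIdeal e where
  toFun x := ⟨x * (e * a * e), Submodule.mem_span_singleton.2 ⟨x * (e * a), by
    simp [mul_assoc]⟩⟩
  map_add' x y := Subtype.ext (by simp [add_mul])
  map_smul' c x := Subtype.ext (by simp)

/-- An isomorphism `D(A e) ≅ e A` of `(e A e, A)`-bimodules. The actions on `D(A e)` are
`(f a)(x) = f(a x)` for `a ∈ A` and `(b f)(x) = f(x b)` for `b = e a e ∈ e A e`. -/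
structure DualBimoduleIso (e : A) where
  toEquiv : (leftIdeal e →ₗ[K] K) ≃ₗ[K] rightIdeal e
  map_right : ∀ (f : leftIdeal e →ₗ[K] K) (a : A),
    (toEquiv (f ∘ₗ Algebra.lsmul K K (leftIdeal e) a) : A) = toEquiv f * a
  map_left : ∀ (f : leftIdeal e →ₗ[K] K) (a : A),
    (toEquiv (f ∘ₗ mulRightCorner K e a) : A) = (e * a * e) * toEquiv f

variable (A)

/-- `A` is gendo-symmetric if the right module `A` has dominant dimension at least two and
`D(A e) ≅ e A` as `(e A e, A)`-bimodules, where `e A` is the minimal faithful projective-injective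
right `A`-module. -/
structure IsGendoSymmetric : Prop where
  two_le_dominantDimension : 2 ≤ dominantDimension Aᵐᵒᵖ A
  exists_iso : ∃ e : A, IsMinimalFaithfulProjInj e ∧ Nonempty (DualBimoduleIso K e)

end GendoSymmetric

/-! Let `R` and `S` be opposite algebras acting on the regular bimodule `T`, let `e` be the given
idempotent and write `M^* = Hom_R(M, T)`. The bimodule isomorphism amounts to a symmetric trace form
that identifies `T e` with `D(e R)`. This structure is left-right symmetric, so each lemma serves
both sides through `CornerTrace.swap`. Dominant dimension at least two becomes the double
centralizer condition `X ≅ Hom_{eRe}(e R, e X)`, and for `T` this condition passes from `R` to `S`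
(`isCornerComplete_op`).

The symmetry of the trace gives the key identification `Hom_S(D(Y), T) ≅ Hom_{eRe}(e R, e Y)` for
finite-dimensional `Y` (`exists_hom_dual`, `exists_cornerLinear`). Hence `Y ≅ Hom_S(D(Y), T)` if `Y`
satisfies the double centralizer condition. For `0 → X → E → Y → 0` with `E` projective-injective,
it also shows that `Ext^1_S(D(X), T)` measures the failure of `Y → Hom_{eRe}(e R, e Y)` to be onto.
Iterating over cosyzygies, `X` has infinite dominant dimension exactly when it satisfies the double
centralizer condition and all higher `Ext_S(D(X), T)` vanish (`dominantDimension_eq_top_iff`).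

On the Gorenstein side, vanishing of the higher `Ext(Tr M, T)` means that `M` is reflexive and the
higher `Ext(M^*, T)` vanish (`extVanishes_transpose_iff`). A reflexive `M = Hom_S(M^*, T)` inherits
the double centralizer condition from `T`, and the remaining conditions for `M` and `D(M)` are
exchanged by duality. Conversely, infinite dominant and codominant dimension give `D(M) ≅ M^*`,
which transports the `Ext` conditions and yields some isomorphism `M ≅ M^**`. Evaluation is
injective, hence bijective by dimension. -/

set_option linter.unusedSectionVars false

/-! ### Dimension shifting for `Ext`. -/

section Ext

variable {R : Type u} [Ring R] {Y P M N : Type u} [AddCommGroup Y] [AddCommGroup P]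
  [AddCommGroup M] [AddCommGroup N] [Module R Y] [Module R P] [Module R M] [Module R N]

/-- Since `Ext^1(P, N) = 0`, the long exact sequence makes `Ext^1(M, N)` the cokernel of `Hom(P, N)
→ Hom(Y, N)`. -/
theorem subsingleton_ext_one_iff [Module.Projective R P] {i : Y →ₗ[R] P} {p : P →ₗ[R] M}
    (hi : Function.Injective i) (hp : Function.Surjective p) (hip : Function.Exact i p) :
    Subsingleton (Abelian.Ext.{u} (ModuleCat.of R M) (ModuleCat.of R N) 1) ↔
      ∀ f : Y →ₗ[R] N, ∃ g : P →ₗ[R] N, g ∘ₗ i = f := by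
  let C := ModuleCat.shortComplexOfCompEqZero i p hip.linearMap_comp_eq_zero
  have hC : C.ShortExact := ModuleCat.shortComplex_shortExact C hip hi hp
  have : CategoryTheory.Projective C.X₂ :=
    (IsProjective.iff_projective (R := R) P).1 inferInstance
  constructor
  · intro _ f
    obtain ⟨x, hx⟩ := Abelian.Ext.contravariant_sequence_exact₁ hC (ModuleCat.of R N)
      (Abelian.Ext.mk₀ (ModuleCat.ofHom f)) (add_zero 1) (Subsingleton.elim _ _)
    obtain ⟨g, rfl⟩ := Abelian.Ext.addEquiv₀.symm.surjective x
    refine ⟨g.hom, ?_⟩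
    rw [Abelian.Ext.addEquiv₀_symm_apply, Abelian.Ext.mk₀_comp_mk₀] at hx
    have := (Abelian.Ext.mk₀_bijective _ _).1 hx
    simpa [C] using congrArg ModuleCat.Hom.hom this
  · intro h
    refine subsingleton_of_forall_eq 0 fun x => ?_
    obtain ⟨y, rfl⟩ := Abelian.Ext.contravariant_sequence_exact₃ hC (ModuleCat.of R N) x
      (Abelian.Ext.eq_zero_of_projective _) (add_zero 1)
    obtain ⟨f, rfl⟩ := Abelian.Ext.addEquiv₀.symm.surjective y
    obtain ⟨g, hg⟩ := h f.hom
    have hf : f = C.f ≫ ModuleCat.ofHom g := by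
      ext1
      exact hg.symm
    rw [Abelian.Ext.addEquiv₀_symm_apply, hf, ← Abelian.Ext.mk₀_comp_mk₀,
      hC.extClass_comp_assoc]

theorem subsingleton_ext_succ_iff [Module.Projective R P] {i : Y →ₗ[R] P} {p : P →ₗ[R] M}
    (hi : Function.Injective i) (hp : Function.Surjective p) (hip : Function.Exact i p) (n : ℕ) :
    Subsingleton (Abelian.Ext.{u} (ModuleCat.of R M) (ModuleCat.of R N) (n + 2)) ↔
      Subsingleton (Abelian.Ext.{u} (ModuleCat.of R Y) (ModuleCat.of R N) (n + 1)) := by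
  let C := ModuleCat.shortComplexOfCompEqZero i p hip.linearMap_comp_eq_zero
  have hC : C.ShortExact := ModuleCat.shortComplex_shortExact C hip hi hp
  have : CategoryTheory.Projective C.X₂ :=
    (IsProjective.iff_projective (R := R) P).1 inferInstance
  have hn : 1 + (n + 1) = n + 2 := by lia
  constructor
  · intro _
    refine subsingleton_of_forall_eq 0 fun x => ?_
    obtain ⟨y, rfl⟩ := Abelian.Ext.contravariant_sequence_exact₁ hC (ModuleCat.of R N) x hn
      (Subsingleton.elim _ _)
    rw [Abelian.Ext.eq_zero_of_projective y, Abelian.Ext.comp_zero]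
  · intro _
    refine subsingleton_of_forall_eq 0 fun x => ?_
    obtain ⟨y, rfl⟩ := Abelian.Ext.contravariant_sequence_exact₃ hC (ModuleCat.of R N) x
      (Abelian.Ext.eq_zero_of_projective _) hn
    have : y = 0 := Subsingleton.elim _ _
    rw [this, Abelian.Ext.comp_zero]

/-- Dimension shifting for the vanishing of all higher `Ext` groups. -/
theorem extVanishes_iff_of_exact [Module.Projective R P] {i : Y →ₗ[R] P} {p : P →ₗ[R] M}
    (hi : Function.Injective i) (hp : Function.Surjective p) (hip : Function.Exact i p) :
    ExtVanishes R M N ↔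
      (∀ f : Y →ₗ[R] N, ∃ g : P →ₗ[R] N, g ∘ₗ i = f) ∧ ExtVanishes R Y N := by
  rw [← subsingleton_ext_one_iff hi hp hip]
  constructor
  · intro h
    refine ⟨h 1 le_rfl, fun n hn => ?_⟩
    obtain ⟨n, rfl⟩ := Nat.exists_eq_add_of_le' hn
    exact (subsingleton_ext_succ_iff hi hp hip n).1 (h _ (by lia))
  · rintro ⟨h₁, h⟩ n hn
    obtain ⟨n, rfl⟩ := Nat.exists_eq_add_of_le' hn
    cases n with
    | zero => exact h₁
    | succ n => exact (subsingleton_ext_succ_iff hi hp hip n).2 (h _ (by lia))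

theorem subsingleton_ext_of_linearEquiv (f : M ≃ₗ[R] Y) (n : ℕ)
    [Subsingleton (Abelian.Ext.{u} (ModuleCat.of R M) (ModuleCat.of R N) n)] :
    Subsingleton (Abelian.Ext.{u} (ModuleCat.of R Y) (ModuleCat.of R N) n) := by
  refine subsingleton_of_forall_eq 0 fun x => ?_
  have h : (Abelian.Ext.mk₀ f.toModuleIso.hom).comp x (zero_add n) = 0 := Subsingleton.elim _ _
  have := congrArg (fun y => (Abelian.Ext.mk₀ f.toModuleIso.inv).comp y (zero_add n)) h
  rwa [Abelian.Ext.mk₀_comp_mk₀_assoc, Iso.inv_hom_id, Abelian.Ext.mk₀_id_comp,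
    Abelian.Ext.comp_zero] at this

theorem ExtVanishes.of_linearEquiv (f : M ≃ₗ[R] Y) (h : ExtVanishes R M N) : ExtVanishes R Y N :=
  fun n hn => haveI := h n hn; subsingleton_ext_of_linearEquiv f n

end Ext

/-! ### Injective hulls and projective covers from Fitting's lemma. -/

section Fitting

variable {R : Type u} [Ring R]

theorem Module.Injective.of_retract {I E : Type u} [AddCommGroup I] [AddCommGroup E] [Module R I]
    [Module R E] [hI : Module.Injective R I] (i : E →ₗ[R] I) (p : I →ₗ[R] E)
    (h : ∀ x, p (i x) = x) : Module.Injective R E where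
  out _ _ _ _ _ _ f hf g := by
    obtain ⟨k, hk⟩ := hI.out f hf (i ∘ₗ g)
    exact ⟨p ∘ₗ k, fun x => by simp [hk, h]⟩

variable {E : Type u} [AddCommGroup E] [Module R E]

/-- In a direct summand `E` minimal among those with some property, the image of every power of an
endomorphism in the stable range is all of `E`, as soon as that image has the property. -/
theorem range_pow_eq_top_of_minimal [IsArtinian R E] [IsNoetherian R E]
    {C : Submodule R E → Prop} {F : Submodule R E} (p : E →ₗ[R] F) (hp : ∀ x : F, p x = x)
    (hmin : ∀ F' ≤ F, C F' → (∃ q : E →ₗ[R] F', ∀ x : F', q x = x) → F' = F)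
    (g : Module.End R F) (hg : ∀ k, C ((LinearMap.range (g ^ k)).map F.subtype)) :
    ∃ k ≠ 0, LinearMap.range (g ^ k) = ⊤ ∧ LinearMap.ker (g ^ k) = ⊥ := by
  -- Fitting: for large `k`, `F` is the direct sum of the kernel and the range of `g ^ k`. So the
  -- range is again a direct summand of `E`, and minimality applies to it.
  obtain ⟨k, hk, hk0⟩ :=
    (g.eventually_isCompl_ker_pow_range_pow.and (Filter.eventually_ne_atTop 0)).exists
  have hF : (LinearMap.range (g ^ k)).map F.subtype = F := by
    refine hmin _ (Submodule.map_subtype_le _ _) (hg k) ?_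
    let q := Submodule.projectionOnto _ _ hk.symm
    refine ⟨((F.subtype ∘ₗ (LinearMap.range (g ^ k)).subtype ∘ₗ q ∘ₗ p).codRestrict _
      fun x => ⟨_, (q (p x)).2, rfl⟩), ?_⟩
    rintro ⟨_, x, hx, rfl⟩
    ext
    have h₁ : p x = x := hp x
    have h₂ : q x = ⟨x, hx⟩ := Submodule.projectionOnto_apply_left hk.symm ⟨x, hx⟩
    change ((q (p x) : F) : E) = x
    rw [h₁, h₂]
  have htop : LinearMap.range (g ^ k) = ⊤ := by
    apply Submodule.map_injective_of_injective F.injective_subtype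
    rw [hF, Submodule.map_subtype_top]
  refine ⟨k, hk0, htop, ?_⟩
  have := hk.inf_eq_bot
  rwa [htop, inf_top_eq] at this

/-- A submodule of a finite length injective module has an injective hull that is a direct
summand. -/
theorem exists_injectiveHull_le [IsArtinian R E] [IsNoetherian R E] [hE : Module.Injective R E]
    (X : Submodule R E) :
    ∃ (F : Submodule R E) (p : E →ₗ[R] F), X ≤ F ∧ (∀ x : F, p x = x) ∧
      ∀ N : Submodule R F, N ⊓ X.submoduleOf F = ⊥ → N = ⊥ := by
  let C : Set (Submodule R E) := {F | X ≤ F ∧ ∃ p : E →ₗ[R] F, ∀ x : F, p x = x}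
  obtain ⟨F, ⟨hXF, p, hp⟩, hmin⟩ := (wellFounded_lt (α := Submodule R E)).has_min C
    ⟨⊤, le_top, LinearMap.codRestrict ⊤ LinearMap.id fun _ => trivial, fun _ => rfl⟩
  refine ⟨F, p, hXF, hp, fun N hN => ?_⟩
  have hF : Module.Injective R F := .of_retract F.subtype p hp
  -- As `N` meets `X` trivially, `X` embeds in `F ⧸ N`. Extending the inclusion `X → F` over it
  -- gives an endomorphism `g` of `F` that fixes `X` and kills `N`.
  have hinj : Function.Injective (N.mkQ ∘ₗ (X.submoduleOf F).subtype) := by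
    rw [← LinearMap.ker_eq_bot, Submodule.eq_bot_iff]
    intro x hx
    have hxN : (x : F) ∈ N ⊓ X.submoduleOf F := ⟨by simpa using hx, x.2⟩
    rw [hN] at hxN
    exact Subtype.ext (by simpa using hxN)
  obtain ⟨f, hf⟩ := hF.out _ hinj (X.submoduleOf F).subtype
  let g : Module.End R F := f ∘ₗ N.mkQ
  have hgX : ∀ k, ∀ x : F, (x : E) ∈ X → (g ^ k) x = x := by
    intro k x hx
    induction k with
    | zero => rfl
    | succ k ih => rw [pow_succ', Module.End.mul_apply, ih]; exact hf ⟨x, hx⟩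
  obtain ⟨k, hk0, -, hker⟩ := range_pow_eq_top_of_minimal (C := fun F' => X ≤ F') p hp
    (fun F' hle hX hq => by
      by_contra hne
      exact hmin F' ⟨hX, hq⟩ (lt_of_le_of_ne hle hne)) g
    (fun k x hx => ⟨⟨x, hXF hx⟩, ⟨⟨x, hXF hx⟩, hgX k _ hx⟩, rfl⟩)
  rw [Submodule.eq_bot_iff]
  intro x hx
  have hgx : g x = 0 := by simp [g, (Submodule.Quotient.mk_eq_zero N).2 hx]
  -- This needs `k ≠ 0`: the zeroth power does not kill `N`.
  have : x ∈ LinearMap.ker (g ^ k) := by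
    obtain ⟨k, rfl⟩ := Nat.exists_eq_succ_of_ne_zero hk0
    rw [LinearMap.mem_ker, pow_succ, Module.End.mul_apply, hgx, map_zero]
  simpa [hker] using this

/-- A surjection from a finite length projective module restricts to a projective cover on some
direct summand. -/
theorem exists_projectiveCover_le [IsArtinian R E] [IsNoetherian R E] [Module.Projective R E]
    {M : Type u} [AddCommGroup M] [Module R M] (π : E →ₗ[R] M) (hπ : Function.Surjective π) :
    ∃ F : Submodule R E, Module.Projective R F ∧ Function.Surjective (π ∘ₗ F.subtype) ∧
      ∀ N : Submodule R F, N ⊔ LinearMap.ker (π ∘ₗ F.subtype) = ⊤ → N = ⊤ := by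
  let C : Set (Submodule R E) := {F | F.map π = ⊤ ∧ ∃ p : E →ₗ[R] F, ∀ x : F, p x = x}
  obtain ⟨F, ⟨hF, p, hp⟩, hmin⟩ := (wellFounded_lt (α := Submodule R E)).has_min C
    ⟨⊤, by simpa [LinearMap.range_eq_top] using hπ,
      LinearMap.codRestrict ⊤ LinearMap.id fun _ => trivial, fun _ => rfl⟩
  have hproj : Module.Projective R F := .of_split F.subtype p (LinearMap.ext hp)
  have hsurj : Function.Surjective (π ∘ₗ F.subtype) := by
    rw [← LinearMap.range_eq_top, LinearMap.range_comp, Submodule.range_subtype, hF]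
  refine ⟨F, hproj, hsurj, fun N hN => ?_⟩
  have hNsurj : Function.Surjective ((π ∘ₗ F.subtype) ∘ₗ N.subtype) := by
    rw [← LinearMap.range_eq_top, LinearMap.range_comp, Submodule.range_subtype]
    have := congrArg (Submodule.map (π ∘ₗ F.subtype)) hN
    rwa [Submodule.map_sup, LinearMap.le_ker_iff_map.1 le_rfl, sup_bot_eq,
      Submodule.map_top, LinearMap.range_eq_top.2 hsurj] at this
  -- Because `N` already maps onto `M`, the map `F → M` lifts through `N`. The resulting
  -- endomorphism has image in `N` and commutes with `π`; a positive power of it is onto.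
  obtain ⟨f, hf⟩ := Module.projective_lifting_property _ (π ∘ₗ F.subtype) hNsurj
  let g : Module.End R F := N.subtype ∘ₗ f
  have hg : ∀ x, π (g x) = π x := fun x => LinearMap.congr_fun hf x
  have hgk : ∀ k, ∀ x, π ((g ^ k) x : F) = π x := by
    intro k x
    induction k with
    | zero => rfl
    | succ k ih => rw [pow_succ', Module.End.mul_apply, hg, ih]
  obtain ⟨k, hk0, htop, -⟩ := range_pow_eq_top_of_minimal (C := fun F' => F'.map π = ⊤) p hp
    (fun F' hle hX hq => by
      by_contra hne
      exact hmin F' ⟨hX, hq⟩ (lt_of_le_of_ne hle hne)) g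
    (fun k => by
      rw [eq_top_iff]
      intro y _
      obtain ⟨x, rfl⟩ := hsurj y
      exact ⟨(g ^ k) x, ⟨_, ⟨x, rfl⟩, rfl⟩, hgk k x⟩)
  rw [eq_top_iff, ← htop]
  obtain ⟨k, rfl⟩ := Nat.exists_eq_succ_of_ne_zero hk0
  rintro _ ⟨x, rfl⟩
  rw [pow_succ', Module.End.mul_apply]
  exact (f _).2

theorem exists_projectiveCover [IsArtinianRing R] (M : Type u) [AddCommGroup M] [Module R M]
    [Module.Finite R M] :
    ∃ (P : Type u) (_ : AddCommGroup P) (_ : Module R P) (π : P →ₗ[R] M),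
      Module.Finite R P ∧ Module.Projective R P ∧ Function.Surjective π ∧
        ∀ N : Submodule R P, N ⊔ LinearMap.ker π = ⊤ → N = ⊤ := by
  obtain ⟨n, f, hf⟩ := Module.Finite.exists_fin' R M
  obtain ⟨F, h₁, h₂, h₃⟩ := exists_projectiveCover_le f hf
  exact ⟨F, inferInstance, inferInstance, _, inferInstance, h₁, h₂, h₃⟩

theorem exists_minimalProjectivePresentation [IsArtinianRing R] (M : Type u) [AddCommGroup M]
    [Module R M] [Module.Finite R M] : Nonempty (MinimalProjectivePresentation R M) := by
  obtain ⟨P₀, _, _, π, _, h₀, hπ, hmin₀⟩ := exists_projectiveCover (R := R) M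
  obtain ⟨P₁, _, _, d, _, h₁, hd, hmin₁⟩ := exists_projectiveCover (R := R) (LinearMap.ker π)
  refine ⟨{
    P₀ := P₀
    P₁ := P₁
    projective₀ := h₀
    projective₁ := h₁
    π := π
    d := (LinearMap.ker π).subtype ∘ₗ d
    π_surjective := hπ
    exact := ?_
    superfluous₀ := hmin₀
    superfluous₁ := ?_ }⟩
  · rw [LinearMap.exact_iff, LinearMap.range_comp, LinearMap.range_eq_top.2 hd]
    simp
  · rwa [LinearMap.ker_comp_of_ker_eq_bot _ (Submodule.ker_subtype _)]

/-- A finite free cover of `M` lifts to `P`, and its image together with the superfluous kernel is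
everything. Minimal presentations carry no finiteness assumption, so it is recovered here. -/
theorem Module.Finite.of_superfluous_ker {P M : Type u} [AddCommGroup P] [Module R P]
    [AddCommGroup M] [Module R M] [Module.Finite R M] (π : P →ₗ[R] M)
    (hπ : Function.Surjective π) (h : ∀ N : Submodule R P, N ⊔ LinearMap.ker π = ⊤ → N = ⊤) :
    Module.Finite R P := by
  obtain ⟨n, f, hf⟩ := Module.Finite.exists_fin' R M
  obtain ⟨g, hg⟩ := Module.projective_lifting_property π f hπ
  refine Module.Finite.of_surjective g (LinearMap.range_eq_top.1 (h _ ?_))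
  rw [eq_top_iff]
  intro x _
  obtain ⟨y, hy⟩ := hf (π x)
  have hgy : π (g y) = π x := by rw [← hy, ← hg]; rfl
  exact Submodule.mem_sup.2 ⟨g y, ⟨y, rfl⟩, x - g y, by simp [hgy], by simp⟩

end Fitting

/-- An anti-isomorphism of `K`-algebras. -/
structure AntiEquiv (K R S : Type u) [Field K] [Ring R] [Ring S] [Algebra K R]
    [Algebra K S] extends R ≃ₗ[K] S where
  map_mul_rev : ∀ a b, toFun (a * b) = toFun b * toFun a

namespace AntiEquiv

variable {K R S : Type u} [Field K] [Ring R] [Ring S] [Algebra K R] [Algebra K S]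

instance : CoeFun (AntiEquiv K R S) fun _ => R → S := ⟨fun θ => θ.toLinearEquiv⟩

variable (θ : AntiEquiv K R S)

theorem map_mul (a b : R) : θ (a * b) = θ b * θ a := θ.map_mul_rev a b

/-- The inverse of an anti-isomorphism. -/
def symm : AntiEquiv K S R where
  toLinearEquiv := θ.toLinearEquiv.symm
  map_mul_rev a b := by
    apply θ.toLinearEquiv.injective
    change θ (θ.toLinearEquiv.symm (a * b)) =
      θ (θ.toLinearEquiv.symm b * θ.toLinearEquiv.symm a)
    rw [θ.map_mul]
    simp

@[simp] theorem symm_symm : θ.symm.symm = θ := rfl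

@[simp] theorem apply_symm_apply (s : S) : θ (θ.symm s) = s := θ.toLinearEquiv.apply_symm_apply s

@[simp] theorem symm_apply_apply (r : R) : θ.symm (θ r) = r := θ.toLinearEquiv.symm_apply_apply r

@[simp] theorem map_add (a b : R) : θ (a + b) = θ a + θ b := _root_.map_add θ.toLinearEquiv a b

@[simp] theorem map_smul (c : K) (a : R) : θ (c • a) = c • θ a :=
  _root_.map_smul θ.toLinearEquiv c a

@[simp] theorem map_zero : θ 0 = 0 := _root_.map_zero θ.toLinearEquiv

@[simp] theorem map_one : θ 1 = 1 := by
  have h := θ.map_mul (θ.symm 1) 1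
  rw [mul_one, apply_symm_apply, mul_one] at h
  exact h.symm

end AntiEquiv

/-! ### The double centralizer condition relative to an idempotent. -/

section Corner

variable {R : Type u} [Ring R] (e : R) (X : Type u) [AddCommGroup X] [Module R X]

/-- No nonzero element of `X` is annihilated by `e R`. -/
def IsCornerFaithful : Prop := ∀ x : X, (∀ r : R, e • r • x = 0) → x = 0

/-- Every `e R e`-linear map `e R → X` is given by the action of `e R` on an element of `X`. The map
is represented by an additive map on `R`, of which only the values on `e R` matter. -/
def IsCornerComplete : Prop := ∀ φ : R →+ X, (∀ s r, φ (e * (s * (e * r))) = e • s • e • φ r) →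
  ∃ x : X, ∀ r : R, φ (e * r) = e • r • x

variable {e X} {Y : Type u} [AddCommGroup Y] [Module R Y]

theorem IsCornerFaithful.of_injective (h : IsCornerFaithful e Y) (f : X →ₗ[R] Y)
    (hf : Function.Injective f) : IsCornerFaithful e X := fun x hx =>
  hf <| by
    rw [map_zero]
    exact h _ fun r => by rw [← map_smul, ← map_smul, hx, map_zero]

theorem IsCornerFaithful.pi {ι : Type u} {X : ι → Type u} [∀ i, AddCommGroup (X i)]
    [∀ i, Module R (X i)] (h : ∀ i, IsCornerFaithful e (X i)) : IsCornerFaithful e (∀ i, X i) :=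
  fun _ hx => funext fun i => h i _ fun r => congrFun (hx r) i

theorem IsCornerComplete.pi {ι : Type u} {X : ι → Type u} [∀ i, AddCommGroup (X i)]
    [∀ i, Module R (X i)] (h : ∀ i, IsCornerComplete e (X i)) : IsCornerComplete e (∀ i, X i) := by
  intro φ hφ
  choose x hx using fun i => h i ((Pi.evalAddMonoidHom X i).comp φ)
    fun s r => congrFun (hφ s r) i
  exact ⟨x, fun r => funext fun i => hx i r⟩

theorem IsCornerComplete.of_retract (h : IsCornerComplete e Y) (f : X →ₗ[R] Y) (g : Y →ₗ[R] X)
    (hgf : ∀ x, g (f x) = x) : IsCornerComplete e X := by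
  intro φ hφ
  obtain ⟨y, hy⟩ := h (f.toAddMonoidHom.comp φ) fun s r => by simp [hφ]
  refine ⟨g y, fun r => ?_⟩
  rw [← map_smul, ← map_smul, ← hy]
  simp [hgf]

/-- The kernel of a map from a complete to a faithful module is complete. -/
theorem IsCornerComplete.of_exact {Z : Type u} [AddCommGroup Z] [Module R Z]
    (h : IsCornerComplete e Y) (hZ : IsCornerFaithful e Z)
    {f : X →ₗ[R] Y} {g : Y →ₗ[R] Z} (hf : Function.Injective f) (hfg : Function.Exact f g) :
    IsCornerComplete e X := by
  intro φ hφ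
  obtain ⟨y, hy⟩ := h (f.toAddMonoidHom.comp φ) fun s r => by simp [hφ]
  have hgy : g y = 0 := hZ _ fun r => by
    rw [← map_smul, ← map_smul, ← hy]
    exact hfg.apply_apply_eq_zero _
  obtain ⟨x, rfl⟩ := (hfg y).1 hgy
  refine ⟨x, fun r => hf ?_⟩
  rw [map_smul, map_smul, ← hy]
  rfl

/-- The cokernel of a map from a complete to a faithful module is faithful. -/
theorem IsCornerFaithful.of_exact {Z : Type u} [AddCommGroup Z] [Module R Z]
    (he : e * e = e) (hX : IsCornerComplete e X) (hY : IsCornerFaithful e Y)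
    {f : X →ₗ[R] Y} {g : Y →ₗ[R] Z} (hf : Function.Injective f) (hg : Function.Surjective g)
    (hfg : Function.Exact f g) : IsCornerFaithful e Z := by
  intro z hz
  obtain ⟨y, rfl⟩ := hg z
  -- The preimages in `X` of the elements `e r y` form an `e R e`-linear map on `e R`. Completeness
  -- of `X` represents it by some `x`, and faithfulness of `Y` forces `f x = y`.
  have hr : ∀ r : R, ∃ x, f x = e • r • y := fun r =>
    (hfg _).1 (by rw [map_smul, map_smul, hz])
  choose φ hφ using hr
  obtain ⟨x, hx⟩ := hX (AddMonoidHom.mk' φ fun a b => hf (by simp [hφ, add_smul])) fun s r => hf (by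
    simp [hφ, smul_smul, mul_assoc, ← mul_assoc e e, he])
  have : f x = y := by
    rw [← sub_eq_zero]
    refine hY _ fun r => ?_
    have := congrArg f (hx r)
    simp only [AddMonoidHom.mk'_apply, hφ, map_smul, smul_smul, ← mul_assoc, he] at this
    rw [smul_sub, smul_sub, sub_eq_zero, smul_smul, smul_smul, this]
  rw [← this]
  exact hfg.apply_apply_eq_zero x

variable (e X) in
/-- If `R e` is a minimal faithful projective-injective module, this says that `X` has dominant
dimension at least two. -/
structure IsCornerDetermined : Prop where
  faithful : IsCornerFaithful e X
  complete : IsCornerComplete e X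

theorem IsCornerDetermined.of_linearEquiv (h : IsCornerDetermined e Y) (f : X ≃ₗ[R] Y) :
    IsCornerDetermined e X :=
  ⟨h.faithful.of_injective f.toLinearMap f.injective,
    h.complete.of_retract f.toLinearMap f.symm.toLinearMap f.symm_apply_apply⟩

/-- `Hom_S(Z, T)` inherits the property from the bimodule `T`. -/
theorem IsCornerDetermined.hom {S T Z : Type u} [Ring S] [AddCommGroup T] [Module R T] [Module S T]
    [SMulCommClass R S T] [SMulCommClass S R T] [AddCommGroup Z] [Module S Z]
    (h : IsCornerDetermined e T) :
    IsCornerDetermined e (Z →ₗ[S] T) := by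
  refine ⟨fun f hf => LinearMap.ext fun z => h.faithful _ fun r => LinearMap.congr_fun (hf r) z,
    fun φ hφ => ?_⟩
  -- The representing element is found pointwise; faithfulness makes it unique, hence `S`-linear in
  -- `z`.
  choose x hx using fun z : Z => h.complete ((LinearMap.evalAddMonoidHom z).comp φ)
    fun s r => LinearMap.congr_fun (hφ s r) z
  simp only [AddMonoidHom.comp_apply, LinearMap.evalAddMonoidHom_apply] at hx
  refine ⟨{ toFun := x, map_add' := fun y z => ?_, map_smul' := fun s z => ?_ },
    fun r => LinearMap.ext fun z => hx z r⟩
  · rw [← sub_eq_zero]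
    refine h.faithful _ fun r => ?_
    simp only [smul_sub, smul_add, ← hx, map_add, sub_self]
  · rw [← sub_eq_zero]
    refine h.faithful _ fun r => ?_
    simp only [smul_sub, RingHom.id_apply, smul_comm _ s, ← hx, map_smul, sub_self]

end Corner

/-- An idempotent `e` of `R`, corresponding to the idempotent `θ e` of `S = R^op`, with a trace form
on `e R e` that induces a perfect pairing between `e R` and `R e`. The regular bimodule is `T`, with
`R` acting from one side and `S` from the other. -/
structure CornerTrace (K R S T : Type u) [Field K] [Ring R] [Ring S] [Algebra K R] [Algebra K S]
    [AddCommGroup T] [Module K T] [Module R T] [Module S T] where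
  θ : AntiEquiv K R S
  one : T
  smul_one : ∀ r : R, r • one = θ r • one
  bijective_smul_one : Function.Bijective fun r : R => r • one
  e : R
  idem : e * e = e
  τ : T →ₗ[K] K
  trace : ∀ (r : R) (t : T), τ (e • r • e • θ e • t) = τ (e • θ e • θ r • θ e • t)
  rep : ∀ F : R →ₗ[K] K, ∃ t : T, θ e • t = t ∧ ∀ r : R, τ (e • r • t) = F (e * r)
  sep : ∀ t : T, (∀ r : R, τ (e • r • θ e • t) = 0) → θ e • t = 0
  rep_op : ∀ F : S →ₗ[K] K, ∃ t : T, e • t = t ∧ ∀ s : S, τ (θ e • s • t) = F (θ e * s)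
  sep_op : ∀ t : T, (∀ s : S, τ (θ e • s • e • t) = 0) → e • t = 0
  faithful : IsCornerFaithful e T
  faithful_op : IsCornerFaithful (θ e) T

/-! ### The projective-injective module `T e` and the trace form. -/

namespace CornerTrace

variable {K R S T : Type u} [Field K] [Ring R] [Ring S] [Algebra K R] [Algebra K S]
    [AddCommGroup T] [Module K T] [Module R T] [Module S T] [IsScalarTower K R T]
    [IsScalarTower K S T] [SMulCommClass R S T] [SMulCommClass S R T]
    (c : CornerTrace K R S T)

/-- Exchange the roles of `R` and `S`. -/
def swap : CornerTrace K S R T where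
  θ := c.θ.symm
  one := c.one
  smul_one s := by simpa using (c.smul_one (c.θ.symm s)).symm
  bijective_smul_one := by
    have := c.bijective_smul_one.comp c.θ.symm.toLinearEquiv.bijective
    convert this using 2 with s
    simpa using (c.smul_one (c.θ.symm s)).symm
  e := c.θ c.e
  idem := by rw [← c.θ.map_mul, c.idem]
  τ := c.τ
  trace s t := by
    have := c.trace (c.θ.symm s) t
    simp only [AntiEquiv.apply_symm_apply, AntiEquiv.symm_apply_apply] at this ⊢
    rw [smul_comm (c.θ c.e) c.e t, smul_comm s c.e, smul_comm (c.θ c.e) c.e, ← this,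
      smul_comm (c.θ c.e) c.e, smul_comm (c.θ c.e) (c.θ.symm s), smul_comm (c.θ c.e) c.e]
  rep := by simpa using c.rep_op
  sep := by simpa using c.sep_op
  rep_op := by simpa using c.rep
  sep_op := by simpa using c.sep
  faithful := c.faithful_op
  faithful_op := by simpa using c.faithful

theorem e_smul_e_smul {X : Type u} [AddCommGroup X] [Module R X] (x : X) :
    c.e • c.e • x = c.e • x := by rw [smul_smul, c.idem]

theorem cornerLinear_mul_left {X : Type u} [AddCommGroup X] [Module R X] {φ : R →+ X}
    (hφ : ∀ s r, φ (c.e * (s * (c.e * r))) = c.e • s • c.e • φ r) (r : R) :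
    φ (c.e * r) = c.e • φ r := by
  simpa [← mul_assoc, c.idem, c.e_smul_e_smul] using hφ 1 r

/-- Linearity over `K` need not be assumed: on `e R` a scalar acts as an element of `e R e`. -/
theorem cornerLinear_smul {X : Type u} [AddCommGroup X] [Module K X] [Module R X]
    [IsScalarTower K R X] {φ : R →+ X}
    (hφ : ∀ s r, φ (c.e * (s * (c.e * r))) = c.e • s • c.e • φ r) (k : K) (r : R) :
    φ (c.e * (k • r)) = k • φ (c.e * r) := by
  have h : c.e * (k • r) = c.e * (algebraMap K R k * (c.e * r)) := by
    rw [← Algebra.smul_def, mul_smul_comm, mul_smul_comm, ← mul_assoc, c.idem]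
  rw [h, hφ, algebraMap_smul, smul_comm, c.e_smul_e_smul, c.cornerLinear_mul_left hφ]

/-- The regular bimodule is the regular module over `R`. -/
noncomputable def equivT : R ≃ₗ[R] T :=
  LinearEquiv.ofBijective (LinearMap.toSpanSingleton R T c.one) c.bijective_smul_one

/-- The summand `T e = {t | t e = t}` of the regular module. -/
def summand : Submodule R T where
  carrier := {t | c.θ c.e • t = t}
  add_mem' := by
    intro a b ha hb
    simp only [Set.mem_ofPred_eq] at ha hb ⊢
    rw [smul_add, ha, hb]
  zero_mem' := smul_zero _
  smul_mem' := by
    intro r t ht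
    simp only [Set.mem_ofPred_eq] at ht ⊢
    rw [smul_comm, ht]

/-- Nondegeneracy in working form: `rep` supplies elements of `T e`, and identities between them are
checked on pairings. -/
theorem eq_of_pairing_eq {x y : T} (hx : c.θ c.e • x = x) (hy : c.θ c.e • y = y)
    (h : ∀ r : R, c.τ (c.e • r • x) = c.τ (c.e • r • y)) : x = y := by
  have hz : c.θ c.e • (x - y) = x - y := by rw [smul_sub, hx, hy]
  rw [← sub_eq_zero, ← hz]
  refine c.sep _ fun r => ?_
  rw [hz]
  simp [smul_sub, h]

theorem summand_ext {x y : c.summand}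
    (h : ∀ r : R, c.τ (c.e • r • (x : T)) = c.τ (c.e • r • (y : T))) : x = y :=
  Subtype.ext (c.eq_of_pairing_eq x.2 y.2 h)

theorem projective_summand : Module.Projective R c.summand := by
  have : Module.Projective R T := .of_equiv c.equivT
  refine .of_split c.summand.subtype
    { toFun := fun t => ⟨c.θ c.e • t, by
        change _ • _ • _ = _
        rw [smul_smul, ← c.θ.map_mul, c.idem]⟩
      map_add' := fun _ _ => Subtype.ext (smul_add _ _ _)
      map_smul' := fun _ _ => Subtype.ext (smul_comm _ _ _) } ?_
  ext x
  exact x.2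

/-- `Hom_R(X, T e)` is the dual of `e X`. -/
theorem exists_hom_summand {X : Type u} [AddCommGroup X] [Module K X] [Module R X]
    [IsScalarTower K R X] (l : X →ₗ[K] K) :
    ∃ f : X →ₗ[R] c.summand, ∀ (x : X) (r : R), c.τ (c.e • r • (f x : T)) = l (c.e • r • x) := by
  have (x : X) : ∃ t : c.summand, ∀ r : R, c.τ (c.e • r • (t : T)) = l (c.e • r • x) := by
    obtain ⟨t, h₁, h₂⟩ := c.rep (l ∘ₗ (LinearMap.toSpanSingleton R X x).restrictScalars K)
    exact ⟨⟨t, h₁⟩, fun r => by simpa [mul_smul] using h₂ r⟩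
  choose f hf using this
  refine ⟨{ toFun := f, map_add' := fun x y => c.summand_ext fun r => ?_
            map_smul' := fun s x => c.summand_ext fun r => ?_ }, hf⟩
  · simp only [hf, smul_add, Submodule.coe_add, map_add]
  · have := hf x (r * s)
    simp only [mul_smul] at this
    simp only [hf, RingHom.id_apply, Submodule.coe_smul, this]

/-- `Hom_R(X, T e)` is `D(e X)`, which is exact in `X`; so Baer's criterion reduces to extending a
linear functional. -/
theorem injective_summand : Module.Injective R c.summand := by
  refine Module.Baer.injective fun I g => ?_
  let l : I →ₗ[K] K := c.τ ∘ₗ (c.summand.subtype.restrictScalars K) ∘ₗ g.restrictScalars K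
  obtain ⟨l', hl'⟩ := LinearMap.exists_extend (p := I.restrictScalars K) l
  obtain ⟨f, hf⟩ := c.exists_hom_summand l'
  refine ⟨f, fun x hx => c.summand_ext fun r => ?_⟩
  rw [hf]
  have := LinearMap.congr_fun hl' ⟨c.e • r • x, I.smul_mem _ (I.smul_mem _ hx)⟩
  refine this.trans ?_
  change c.τ (g (c.e • r • ⟨x, hx⟩) : T) = _
  rw [map_smul, map_smul]
  rfl

/-- Represent the functional `r ↦ τ (φ (e r))` by `t`. By `e R e`-linearity, pairing `φ (e r)` with
`e s` equals pairing `t` with `e s e r`, so `φ` is the action on `t`. -/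
theorem isCornerDetermined_summand : IsCornerDetermined c.e c.summand := by
  refine ⟨c.faithful.of_injective c.summand.subtype c.summand.injective_subtype, fun φ hφ => ?_⟩
  have hφe := c.cornerLinear_mul_left hφ
  let F : R →ₗ[K] K :=
    { toFun := fun r => c.τ (φ (c.e * r) : T)
      map_add' := fun a b => by simp [mul_add]
      map_smul' := fun k r => by
        rw [c.cornerLinear_smul hφ]
        simp }
  obtain ⟨t, ht, hF⟩ := c.rep F
  refine ⟨⟨t, ht⟩, fun r => c.summand_ext fun s => ?_⟩
  have h₁ := hF (s * c.e * r)
  have h₂ := hφ s r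
  simp only [F, LinearMap.coe_mk, AddHom.coe_mk, ← mul_assoc, c.idem, mul_smul] at h₁ h₂
  rw [hφe]
  simp only [Submodule.coe_smul]
  rw [h₁, h₂]
  simp

/-- A finite dimensional faithful module embeds into a power of `T e`. -/
theorem exists_embedding {X : Type u} [AddCommGroup X] [Module K X] [Module R X]
    [IsScalarTower K R X] [FiniteDimensional K X] (hX : IsCornerFaithful c.e X) :
    ∃ (n : ℕ) (f : X →ₗ[R] (ULift.{u} (Fin n) → c.summand)), Function.Injective f := by
  -- One coordinate per basis functional: an element in the kernel of all of them satisfies `e R x =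
  -- 0`.
  let b := Module.finBasis K (Module.Dual K X)
  choose f hf using fun i => c.exists_hom_summand (b i)
  refine ⟨_, LinearMap.pi fun i => f i.down, ?_⟩
  rw [← LinearMap.ker_eq_bot, LinearMap.ker_eq_bot']
  intro x hx
  refine hX _ fun r => (Module.forall_dual_apply_eq_zero_iff K _).1 fun l => ?_
  have : ∀ i, b i (c.e • r • x) = 0 := fun i => by
    have h : f i x = 0 := congrFun hx ⟨i⟩
    rw [← hf, h]
    simp
  rw [← b.sum_repr l, LinearMap.sum_apply]
  exact Finset.sum_eq_zero fun i _ => by rw [LinearMap.smul_apply, this, smul_zero]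

/-- Projective-injective modules have dominant dimension at least two. -/
theorem isCornerDetermined_of_projective_of_injective [FiniteDimensional K T] (I : Type u)
    [AddCommGroup I] [Module R I] [Module.Projective R I] [hI : Module.Injective R I] :
    IsCornerDetermined c.e I := by
  obtain ⟨s, hs⟩ := Module.projective_def'.1 (inferInstance : Module.Projective R I)
  obtain ⟨n, f, hf⟩ := c.exists_embedding c.faithful
  -- `I` embeds in a product of copies of `R ≅ T`, and `T` in a power of `T e`. Injectivity makes
  -- `I` a retract of this product; no finiteness of `I` is needed.
  let j : I →ₗ[R] (I → ULift.{u} (Fin n) → c.summand) :=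
    LinearMap.pi fun i => f ∘ₗ c.equivT.toLinearMap ∘ₗ Finsupp.lapply i ∘ₗ s
  have hj : Function.Injective j := by
    intro x y hxy
    have hs' : s x = s y := Finsupp.ext fun i =>
      c.equivT.injective (hf (congrFun hxy i))
    have := LinearMap.congr_fun hs
    rw [← LinearMap.id_apply (R := R) x, ← this, LinearMap.comp_apply, hs', ← LinearMap.comp_apply,
      this, LinearMap.id_apply]
  have hQ : IsCornerDetermined c.e (I → ULift.{u} (Fin n) → c.summand) :=
    ⟨.pi fun _ => .pi fun _ => c.isCornerDetermined_summand.faithful,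
      .pi fun _ => .pi fun _ => c.isCornerDetermined_summand.complete⟩
  obtain ⟨p, hp⟩ := hI.out j hj LinearMap.id
  exact ⟨hQ.faithful.of_injective j hj, hQ.complete.of_retract j p hp⟩

/-- The double centralizer property passes to the other side. -/
theorem isCornerComplete_op (h : IsCornerComplete c.e T) : IsCornerComplete (c.θ c.e) T := by
  intro φ hφ
  have hφe : ∀ s, φ (c.θ c.e * s) = c.θ c.e • φ s := c.swap.cornerLinear_mul_left hφ
  have hσ : ∀ t : T, c.θ c.e • c.θ c.e • t = c.θ c.e • t := c.swap.e_smul_e_smul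
  have hext : ∀ {x y : T}, c.e • x = x → c.e • y = y →
      (∀ s : S, c.τ (c.θ c.e • s • x) = c.τ (c.θ c.e • s • y)) → x = y := fun {x y} hx hy =>
    c.swap.eq_of_pairing_eq (x := x) (y := y) (by simpa [swap] using hx) (by simpa [swap] using hy)
  -- The adjoint of `φ`: the functional `s ↦ τ (e r φ (θ e s))` is represented by some `ψ r` in `e
  -- T`. The double centralizer condition over `R` will apply to `ψ`.
  let F (r : R) : S →ₗ[K] K :=
    { toFun := fun s => c.τ (c.e • r • φ (c.θ c.e * s))
      map_add' := fun a b => by simp [mul_add]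
      map_smul' := fun k s => by
        have h : φ (c.θ c.e * (k • s)) = k • φ (c.θ c.e * s) := c.swap.cornerLinear_smul hφ k s
        rw [h, smul_comm r, smul_comm c.e, map_smul, RingHom.id_apply] }
  choose ψ hψe hψ using fun r => c.rep_op (F r)
  have hψ (r : R) (s : S) : c.τ (c.θ c.e • s • ψ r) = c.τ (c.e • r • c.θ c.e • φ s) := by
    rw [hψ]
    change c.τ (c.e • r • φ (c.θ c.e * (c.θ c.e * s))) = _
    rw [hφe, hφe, hσ]
  have hψadd (a b : R) : ψ (a + b) = ψ a + ψ b := by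
    refine hext (hψe _) (by rw [smul_add, hψe, hψe]) fun s => ?_
    simp only [hψ, smul_add, add_smul, map_add]
  -- That `ψ` is `e R e`-linear uses the symmetry of the trace twice: to move `b` across to `φ`,
  -- then back.
  obtain ⟨x, hx⟩ := h (AddMonoidHom.mk' ψ hψadd) fun b r => by
    refine hext (hψe _) (c.e_smul_e_smul _) fun s => ?_
    rw [AddMonoidHom.mk'_apply]
    calc c.τ (c.θ c.e • s • ψ (c.e * (b * (c.e * r))))
        = c.τ (c.e • b • c.e • c.θ c.e • r • φ s) := by
          simp only [hψ, mul_smul, c.e_smul_e_smul, smul_comm r (c.θ c.e)]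
      _ = c.τ (c.e • r • c.θ c.e • φ (c.θ b * (c.θ c.e * s))) := by
          rw [c.trace, ← hφe, hφ]
          simp only [smul_comm r]
      _ = c.τ (c.e • c.θ c.e • c.θ b • c.θ c.e • s • ψ r) := by
          rw [← hψ]
          simp only [mul_smul, smul_comm c.e (_ : S), hψe]
      _ = c.τ (c.θ c.e • s • c.e • b • c.e • ψ r) := by
          rw [← c.trace]
          simp only [smul_comm c.e (_ : S), smul_comm b (_ : S)]
  refine ⟨x, fun s => c.eq_of_pairing_eq (by rw [hφe, hσ]) (hσ _) fun r => ?_⟩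
  have hxr : ψ (c.e * r) = c.e • r • x := hx r
  have h₁ := hψ (c.e * r) s
  rw [hxr, mul_smul, c.e_smul_e_smul, ← hφe] at h₁
  rw [← h₁]
  simp only [smul_comm c.e (_ : S), smul_comm r (_ : S)]

end CornerTrace

/-- The `K`-dual of an `R`-module, as a module over the opposite ring `S`. -/
def DualModule {K R S : Type u} [Field K] [Ring R] [Ring S] [Algebra K R] [Algebra K S]
    (_θ : AntiEquiv K R S) (X : Type u) [AddCommGroup X] [Module K X] : Type u :=
  X →ₗ[K] K

/-! ### Duality between `R`-modules and `S`-modules. -/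

namespace DualModule

variable {K R S : Type u} [Field K] [Ring R] [Ring S] [Algebra K R] [Algebra K S]
  {θ : AntiEquiv K R S} {X Y Z : Type u} [AddCommGroup X] [Module K X] [AddCommGroup Y] [Module K Y]
  [AddCommGroup Z] [Module K Z]

instance : AddCommGroup (DualModule θ X) := inferInstanceAs (AddCommGroup (X →ₗ[K] K))

instance : Module K (DualModule θ X) := inferInstanceAs (Module K (X →ₗ[K] K))

instance : FunLike (DualModule θ X) X K := inferInstanceAs (FunLike (X →ₗ[K] K) X K)

instance : LinearMapClass (DualModule θ X) K X K :=
  inferInstanceAs (LinearMapClass (X →ₗ[K] K) K X K)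

instance [FiniteDimensional K X] : FiniteDimensional K (DualModule θ X) :=
  inferInstanceAs (FiniteDimensional K (X →ₗ[K] K))

@[ext] theorem ext {μ ν : DualModule θ X} (h : ∀ x, μ x = ν x) : μ = ν := LinearMap.ext h

@[simp] theorem add_apply (μ ν : DualModule θ X) (x : X) : (μ + ν) x = μ x + ν x := rfl

@[simp] theorem zero_apply (x : X) : (0 : DualModule θ X) x = 0 := rfl

@[simp] theorem scalar_smul_apply (k : K) (μ : DualModule θ X) (x : X) : (k • μ) x = k * μ x := rfl

theorem eq_zero_of_forall_apply_eq_zero (θ : AntiEquiv K R S) {x : X}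
    (h : ∀ μ : DualModule θ X, μ x = 0) : x = 0 :=
  (Module.forall_dual_apply_eq_zero_iff K x).1 h

theorem exists_apply_eq [FiniteDimensional K X] (F : DualModule θ X →ₗ[K] K) :
    ∃ x, ∀ μ : DualModule θ X, μ x = F μ :=
  ⟨(Module.evalEquiv K X).symm F, fun μ => Module.apply_evalEquiv_symm_apply (R := K) (M := X) μ F⟩

variable [Module R X] [IsScalarTower K R X] [Module R Y] [IsScalarTower K R Y] [Module R Z]
  [IsScalarTower K R Z]

instance : Module S (DualModule θ X) where
  smul s μ := LinearMap.comp (show X →ₗ[K] K from μ) (Algebra.lsmul K K X (θ.symm s))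
  one_smul μ := LinearMap.ext fun x => congrArg μ (by simp)
  mul_smul a b μ := LinearMap.ext fun x => congrArg μ (by
    change θ.symm (a * b) • x = θ.symm b • θ.symm a • x
    rw [θ.symm.map_mul, mul_smul])
  smul_zero _ := rfl
  smul_add _ _ _ := rfl
  add_smul a b μ := LinearMap.ext fun x => by
    change μ (θ.symm (a + b) • x) = μ (θ.symm a • x) + μ (θ.symm b • x)
    rw [← map_add, AntiEquiv.map_add, add_smul]
  zero_smul μ := LinearMap.ext fun x => by
    change μ (θ.symm 0 • x) = 0
    simp

@[simp] theorem smul_apply (s : S) (μ : DualModule θ X) (x : X) : (s • μ) x = μ (θ.symm s • x) :=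
  rfl

instance : IsScalarTower K S (DualModule θ X) where
  smul_assoc k s μ := by
    ext x
    simp [smul_assoc]

/-- The dual of a linear map. -/
def map (θ : AntiEquiv K R S) (f : X →ₗ[R] Y) : DualModule θ Y →ₗ[S] DualModule θ X where
  toFun μ := LinearMap.comp (show Y →ₗ[K] K from μ) (f.restrictScalars K)
  map_add' _ _ := rfl
  map_smul' s μ := LinearMap.ext fun x => congrArg μ (map_smul f (θ.symm s) x).symm

@[simp] theorem map_apply (f : X →ₗ[R] Y) (μ : DualModule θ Y) (x : X) : map θ f μ x = μ (f x) :=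
  rfl

theorem map_injective {f : X →ₗ[R] Y} (hf : Function.Surjective f) :
    Function.Injective (map θ f) := by
  intro μ ν h
  ext y
  obtain ⟨x, rfl⟩ := hf y
  exact congrFun (congrArg DFunLike.coe h) x

theorem map_surjective {f : X →ₗ[R] Y} (hf : Function.Injective f) :
    Function.Surjective (map θ f) := by
  intro μ
  obtain ⟨g, hg⟩ := LinearMap.exists_leftInverse_of_injective (f.restrictScalars K)
    (LinearMap.ker_eq_bot.2 hf)
  refine ⟨LinearMap.comp (show X →ₗ[K] K from μ) g, ?_⟩
  ext x
  exact congrArg μ (LinearMap.congr_fun hg x)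

theorem map_exact {f : X →ₗ[R] Y} {g : Y →ₗ[R] Z} (hg : Function.Surjective g)
    (h : Function.Exact f g) : Function.Exact (map θ g) (map θ f) := by
  intro μ
  constructor
  · intro hμ
    have hker : LinearMap.ker (g.restrictScalars K) ≤ LinearMap.ker (show Y →ₗ[K] K from μ) := by
      intro y hy
      obtain ⟨x, rfl⟩ := (h y).1 hy
      exact congrFun (congrArg DFunLike.coe hμ) x
    obtain ⟨s, hs⟩ := LinearMap.exists_rightInverse_of_surjective (g.restrictScalars K)
      (LinearMap.range_eq_top.2 hg)
    refine ⟨LinearMap.comp (show Y →ₗ[K] K from μ) s, ?_⟩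
    ext y
    have : s (g y) - y ∈ LinearMap.ker (show Y →ₗ[K] K from μ) := hker (by
      have := LinearMap.congr_fun hs (g y)
      simpa [sub_eq_zero] using this)
    have h' : μ (s (g y) - y) = 0 := this
    rw [map_sub, sub_eq_zero] at h'
    exact h'
  · rintro ⟨ν, rfl⟩
    ext x
    change ν (g (f x)) = 0
    rw [h.apply_apply_eq_zero, map_zero]

/-- A finite dimensional module is isomorphic to its double dual. -/
noncomputable def evalEquiv (θ : AntiEquiv K R S) (X : Type u) [AddCommGroup X] [Module K X]
    [Module R X] [IsScalarTower K R X] [FiniteDimensional K X] :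
    X ≃ₗ[R] DualModule θ.symm (DualModule θ X) where
  __ := (Module.evalEquiv K X).toAddEquiv
  map_smul' r x := by
    ext μ
    change μ (r • x) = μ (θ.symm (θ r) • x)
    rw [AntiEquiv.symm_apply_apply]

/-- The dual of a finite dimensional injective module is projective. -/
theorem projective_of_injective [FiniteDimensional K S] [FiniteDimensional K X]
    [hX : Module.Injective R X] : Module.Projective S (DualModule θ X) := by
  have : Module.Finite S (DualModule θ X) := .of_restrictScalars_finite K S _
  obtain ⟨n, q, hq⟩ := Module.Finite.exists_fin' S (DualModule θ X)
  let F := Fin n → S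
  -- The transpose of the free cover `q`. It is split by injectivity of `X`, and the dual of the
  -- splitting, read through `F ≅ D(D(F))`, splits `q`.
  let j : X →ₗ[R] DualModule θ.symm F :=
    { toFun := fun x => { toFun := fun v => q v x
                          map_add' := fun v w => by simp
                          map_smul' := fun k v => by
                            rw [← algebraMap_smul S k v, map_smul, algebraMap_smul]
                            rfl }
      map_add' := fun x y => ext fun v => map_add (q v) x y
      map_smul' := fun r x => ext fun v => by
        change q v (r • x) = q (θ r • v) x
        rw [map_smul q, smul_apply, AntiEquiv.symm_apply_apply] }
  have hjq : ∀ x v, j x v = q v x := fun _ _ => rfl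
  have hj : Function.Injective j := by
    rw [← LinearMap.ker_eq_bot, LinearMap.ker_eq_bot']
    intro x hx
    refine eq_zero_of_forall_apply_eq_zero θ fun μ => ?_
    obtain ⟨v, rfl⟩ := hq μ
    rw [← hjq, hx, zero_apply]
  obtain ⟨p, hp⟩ := hX.out j hj LinearMap.id
  choose s hs using fun μ : DualModule θ X =>
    exists_apply_eq (θ := θ.symm) (X := F) (LinearMap.comp (show X →ₗ[K] K from μ)
      (p.restrictScalars K))
  have hs' : ∀ (μ : DualModule θ X) (ξ : DualModule θ.symm F), ξ (s μ) = μ (p ξ) := hs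
  have hsep : ∀ {v w : F}, (∀ ξ : DualModule θ.symm F, ξ v = ξ w) → v = w := fun h =>
    sub_eq_zero.1 (eq_zero_of_forall_apply_eq_zero θ.symm fun ξ => by rw [map_sub, h, sub_self])
  refine .of_split (M := F)
    { toFun := s
      map_add' := fun μ ν => hsep fun ξ => by simp [hs']
      map_smul' := fun a μ => hsep fun ξ => by
        rw [hs', smul_apply, ← map_smul, ← hs']
        simp } q ?_
  refine LinearMap.ext fun μ => ?_
  ext x
  change q (s μ) x = μ x
  rw [← hjq, hs', hp]
  rfl

end DualModule

/-! ### Maps `D(Y) → T` as `e R e`-linear maps `e R → Y`. -/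

namespace CornerTrace

variable {K R S T : Type u} [Field K] [Ring R] [Ring S] [Algebra K R] [Algebra K S]
    [AddCommGroup T] [Module K T] [Module R T] [Module S T] [IsScalarTower K R T]
    [IsScalarTower K S T] [SMulCommClass R S T] [SMulCommClass S R T]
    (c : CornerTrace K R S T)
    {X E Y : Type u} [AddCommGroup X] [Module K X] [Module R X] [IsScalarTower K R X]
    [AddCommGroup E] [Module K E] [Module R E] [IsScalarTower K R E]
    [AddCommGroup Y] [Module K Y] [Module R Y] [IsScalarTower K R Y]

theorem op_e_smul_op_e_smul {Z : Type u} [AddCommGroup Z] [Module S Z] (z : Z) :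
    c.θ c.e • c.θ c.e • z = c.θ c.e • z := c.swap.e_smul_e_smul z

/-- Faithfulness of `T` over `S` reduces equality to the components `θ e • h μ`, which lie in `T e`
and are detected by the pairing. -/
theorem hom_dual_ext {h h' : DualModule c.θ Y →ₗ[S] T}
    (H : ∀ μ (r : R), c.τ (c.e • r • c.θ c.e • h μ) = c.τ (c.e • r • c.θ c.e • h' μ)) : h = h' := by
  have H' : ∀ μ, c.θ c.e • h μ = c.θ c.e • h' μ := fun μ =>
    c.eq_of_pairing_eq (c.op_e_smul_op_e_smul _) (c.op_e_smul_op_e_smul _) (H μ)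
  refine LinearMap.ext fun μ => sub_eq_zero.1 (c.faithful_op _ fun s => ?_)
  rw [smul_sub, smul_sub, ← map_smul h s, ← map_smul h' s, H', sub_self]

/-- An `e R e`-linear map `e R → Y` induces an `S`-linear map `D(Y) → T`. -/
theorem exists_hom_dual (hT : IsCornerComplete (c.θ c.e) T) {φ : R →+ Y}
    (hφ : ∀ s r, φ (c.e * (s * (c.e * r))) = c.e • s • c.e • φ r) :
    ∃ h : DualModule c.θ Y →ₗ[S] T,
      ∀ μ r, c.τ (c.e • r • c.θ c.e • h μ) = μ (φ (c.e * r)) := by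
  have hφe := c.cornerLinear_mul_left hφ
  let F (μ : DualModule c.θ Y) : R →ₗ[K] K :=
    { toFun := fun r => μ (φ (c.e * r))
      map_add' := fun a b => by simp [mul_add]
      map_smul' := fun k r => by rw [c.cornerLinear_smul hφ, map_smul, RingHom.id_apply] }
  -- `ψ` is the dual of `φ` followed by `D(e R) ≅ T e`. Symmetry of the trace makes it compatible
  -- with the corner of `S`.
  choose ψ hψe hψ using fun μ => c.rep (F μ)
  have hψ (μ : DualModule c.θ Y) (r : R) : c.τ (c.e • r • ψ μ) = μ (φ (c.e * r)) := by
    rw [hψ]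
    change μ (φ (c.e * (c.e * r))) = _
    rw [← mul_assoc, c.idem]
  have hψadd (μ ν) : ψ (μ + ν) = ψ μ + ψ ν :=
    c.eq_of_pairing_eq (hψe _) (by rw [smul_add, hψe, hψe]) fun r => by simp [hψ, smul_add]
  have hψσ (s : S) (ν) : ψ (c.θ c.e • s • c.θ c.e • ν) = c.θ c.e • s • c.θ c.e • ψ ν := by
    refine c.eq_of_pairing_eq (hψe _) (c.op_e_smul_op_e_smul _) fun r => ?_
    have h₁ : c.τ (c.e • r • ψ (c.θ c.e • s • c.θ c.e • ν)) =
        ν (φ (c.e * (c.θ.symm s * (c.e * r)))) := by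
      rw [hψ, hφ, hφe]
      simp only [DualModule.smul_apply, AntiEquiv.symm_apply_apply, c.e_smul_e_smul]
    rw [h₁, ← hψ, mul_smul, mul_smul]
    nth_rewrite 1 [← hψe]
    rw [smul_comm r, c.trace, AntiEquiv.apply_symm_apply]
    simp only [smul_comm r (_ : S)]
  -- So far only the part of `h` in `T e` is known. Completeness of `T` over `S`, applied to `s ↦ ψ
  -- (s μ)`, recovers `h μ` itself.
  have (μ : DualModule c.θ Y) : ∃ t : T, ∀ s, ψ ((c.θ c.e * s) • μ) = c.θ c.e • s • t := by
    refine hT (AddMonoidHom.mk' (fun s => ψ (s • μ)) fun a b => by rw [add_smul, hψadd]) ?_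
    intro s s'
    simp only [AddMonoidHom.mk'_apply, mul_smul, hψσ]
  choose h hh using this
  refine ⟨{ toFun := h, map_add' := fun μ ν => ?_
            map_smul' := fun a μ => ?_ }, fun μ r => ?_⟩
  · refine sub_eq_zero.1 (c.faithful_op _ fun s => ?_)
    rw [smul_sub, smul_sub, smul_add, smul_add, ← hh, ← hh, ← hh, smul_add, hψadd, sub_self]
  · refine sub_eq_zero.1 (c.faithful_op _ fun s => ?_)
    rw [smul_sub, smul_sub, RingHom.id_apply, ← hh, smul_smul s a, ← hh, mul_smul, mul_smul,
      mul_smul, sub_self]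
  · have := hh μ 1
    rw [one_smul, mul_one] at this
    change c.τ (c.e • r • c.θ c.e • h μ) = _
    rw [← this, hψ, DualModule.smul_apply, AntiEquiv.symm_apply_apply, hφe, c.e_smul_e_smul]

/-- An `S`-linear map `D(Y) → T` comes from an `e R e`-linear map `e R → Y`. -/
theorem exists_cornerLinear [FiniteDimensional K Y] (h : DualModule c.θ Y →ₗ[S] T) :
    ∃ φ : R →+ Y, (∀ s r, φ (c.e * (s * (c.e * r))) = c.e • s • c.e • φ r) ∧
      ∀ μ r, c.τ (c.e • r • c.θ c.e • h μ) = μ (φ (c.e * r)) := by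
  -- The inverse construction: `φ r` is the element of `Y ≅ D(D(Y))` defined by the functional `μ ↦
  -- τ (e r (θ e) (h μ))`.
  let F (r : R) : DualModule c.θ Y →ₗ[K] K :=
    c.τ ∘ₗ Algebra.lsmul K K T (c.e * r) ∘ₗ Algebra.lsmul K K T (c.θ c.e) ∘ₗ h.restrictScalars K
  choose φ hφ using fun r => DualModule.exists_apply_eq (F r)
  have hφ (r : R) (μ : DualModule c.θ Y) : μ (φ r) = c.τ (c.e • r • c.θ c.e • h μ) := by
    rw [hφ, smul_smul]
    rfl
  have hsep : ∀ {v w : Y}, (∀ ξ : DualModule c.θ Y, ξ v = ξ w) → v = w := fun h =>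
    sub_eq_zero.1 (DualModule.eq_zero_of_forall_apply_eq_zero c.θ fun ξ => by
      rw [map_sub, h, sub_self])
  refine ⟨AddMonoidHom.mk' φ fun a b => hsep fun μ => by simp [hφ, add_smul], fun s r => ?_,
    fun μ r => ?_⟩
  · refine hsep fun μ => ?_
    have h₁ : μ (c.e • s • c.e • φ r) = (c.θ c.e • c.θ s • c.θ c.e • μ) (φ r) := by
      simp only [DualModule.smul_apply, AntiEquiv.symm_apply_apply]
    rw [AddMonoidHom.mk'_apply, h₁, hφ, hφ]
    simp only [mul_smul, map_smul, c.e_smul_e_smul, c.op_e_smul_op_e_smul]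
    rw [smul_comm r, c.trace]
    simp only [smul_comm r (_ : S)]
  · rw [AddMonoidHom.mk'_apply, hφ, mul_smul, c.e_smul_e_smul]

/-- If `E` has dominant dimension at least two, then for a quotient `Y` of `E` maps `D(Y) → T`
extend to `D(E)` if and only if `Y` satisfies the double centralizer property. -/
theorem forall_exists_extension_iff [FiniteDimensional K E] [FiniteDimensional K Y]
    (hT : IsCornerComplete (c.θ c.e) T) (hE : IsCornerComplete c.e E) {p : E →ₗ[R] Y}
    (hp : Function.Surjective p) :
    (∀ f : DualModule c.θ Y →ₗ[S] T, ∃ g : DualModule c.θ E →ₗ[S] T,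
      g ∘ₗ DualModule.map c.θ p = f) ↔ IsCornerComplete c.e Y := by
  -- Under the correspondence, precomposing with `D(p)` is composing with `p`. As `E` is complete,
  -- the maps that extend are those given by acting on some `p z`.
  constructor
  · intro H φ hφ
    obtain ⟨h, hh⟩ := c.exists_hom_dual hT hφ
    obtain ⟨h', rfl⟩ := H h
    obtain ⟨φ', hφ', hh'⟩ := c.exists_cornerLinear h'
    obtain ⟨z, hz⟩ := hE φ' hφ'
    refine ⟨p z, fun r => sub_eq_zero.1 <|
      DualModule.eq_zero_of_forall_apply_eq_zero c.θ fun μ => ?_⟩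
    rw [map_sub, ← hh, LinearMap.comp_apply, hh', hz, DualModule.map_apply, map_smul p, map_smul p,
      sub_self]
  · intro hY h
    obtain ⟨φ, hφ, hh⟩ := c.exists_cornerLinear h
    obtain ⟨y, hy⟩ := hY φ hφ
    obtain ⟨z, rfl⟩ := hp y
    obtain ⟨h', hh'⟩ := c.exists_hom_dual hT (φ := (LinearMap.toSpanSingleton R E z).toAddMonoidHom)
      (fun s r => by simp [mul_smul])
    refine ⟨h', c.hom_dual_ext fun μ r => ?_⟩
    rw [LinearMap.comp_apply, hh', hh, hy]
    simp [mul_smul]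

/-- A module `Y` of dominant dimension at least two is isomorphic to `Hom_S(D(Y), T)`. -/
theorem nonempty_equiv_hom_dual [FiniteDimensional K Y]
    (hT : IsCornerComplete (c.θ c.e) T) (hY : IsCornerDetermined c.e Y) :
    Nonempty (Y ≃ₗ[R] (DualModule c.θ Y →ₗ[S] T)) := by
  have (y : Y) : ∃ h : DualModule c.θ Y →ₗ[S] T,
      ∀ μ (r : R), c.τ (c.e • r • c.θ c.e • h μ) = μ (c.e • r • y) := by
    obtain ⟨h, hh⟩ := c.exists_hom_dual hT (φ := (LinearMap.toSpanSingleton R Y y).toAddMonoidHom)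
      (fun s r => by simp [mul_smul])
    exact ⟨h, fun μ r => by rw [hh]; simp [mul_smul]⟩
  choose h hh using this
  let f : Y →ₗ[R] (DualModule c.θ Y →ₗ[S] T) :=
    { toFun := h
      map_add' := fun x y => c.hom_dual_ext fun μ r => by simp [hh, smul_add]
      map_smul' := fun a y => c.hom_dual_ext fun μ r => by
        have := hh y μ (r * a)
        simp only [mul_smul] at this
        rw [hh, ← this, RingHom.id_apply, LinearMap.smul_apply, smul_comm a] }
  refine ⟨LinearEquiv.ofBijective f ⟨?_, fun g => ?_⟩⟩
  · rw [← LinearMap.ker_eq_bot, LinearMap.ker_eq_bot']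
    intro y hy
    refine hY.faithful _ fun r => DualModule.eq_zero_of_forall_apply_eq_zero c.θ fun μ => ?_
    have hy : h y = 0 := hy
    rw [← hh, hy]
    simp
  · obtain ⟨φ, hφ, hg⟩ := c.exists_cornerLinear g
    obtain ⟨y, hy⟩ := hY.complete φ hφ
    exact ⟨y, c.hom_dual_ext fun μ r => (hh y μ r).trans (by rw [hg, hy])⟩

end CornerTrace

/-! ### Reflexivity and the transpose. -/

section Bidual

variable (R S T : Type u) [Ring R] [Ring S] [AddCommGroup T] [Module R T] [Module S T]
  [SMulCommClass R S T] [SMulCommClass S R T] (X : Type u) [AddCommGroup X] [Module R X]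

/-- The canonical map `X → Hom_S(Hom_R(X, T), T)`. -/
def bidualEval : X →ₗ[R] ((X →ₗ[R] T) →ₗ[S] T) where
  toFun x :=
    { toFun := fun f => f x
      map_add' := fun _ _ => rfl
      map_smul' := fun _ _ => rfl }
  map_add' x y := LinearMap.ext fun f => map_add f x y
  map_smul' r x := LinearMap.ext fun f => map_smul f r x

@[simp] theorem bidualEval_apply (x : X) (f : X →ₗ[R] T) : bidualEval R S T X x f = f x := rfl

variable {X} {Y : Type u} [AddCommGroup Y] [Module R Y]

/-- Precomposition as a map of `S`-modules. -/
def homPrecomp (f : X →ₗ[R] Y) : (Y →ₗ[R] T) →ₗ[S] (X →ₗ[R] T) where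
  toFun g := g ∘ₗ f
  map_add' _ _ := rfl
  map_smul' _ _ := rfl

end Bidual

namespace CornerTrace

variable {K R S T : Type u} [Field K] [Ring R] [Ring S] [Algebra K R] [Algebra K S]
    [AddCommGroup T] [Module K T] [Module R T] [Module S T] [IsScalarTower K R T]
    [IsScalarTower K S T] [SMulCommClass R S T] [SMulCommClass S R T]

theorem projective_hom (c : CornerTrace K R S T)
    (P : Type u) [AddCommGroup P] [Module R P] [Module.Finite R P]
    [Module.Projective R P] : Module.Projective S (P →ₗ[R] T) := by
  obtain ⟨n, q, hq⟩ := Module.Finite.exists_fin' R P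
  obtain ⟨s, hs⟩ := Module.projective_lifting_property q LinearMap.id hq
  have : Module.Free S T := .of_equiv c.swap.equivT
  refine .of_split (M := Fin n → T)
    { toFun := fun f i => f (q (Pi.single i 1))
      map_add' := fun _ _ => rfl
      map_smul' := fun _ _ => rfl }
    { toFun := fun t => ∑ i, (LinearMap.toSpanSingleton R T (t i)) ∘ₗ LinearMap.proj i ∘ₗ s
      map_add' := fun t t' => LinearMap.ext fun x => by simp [Finset.sum_add_distrib]
      map_smul' := fun a t => LinearMap.ext fun x => by
        simp [Finset.smul_sum, smul_comm a] } ?_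
  refine LinearMap.ext fun f => LinearMap.ext fun x => ?_
  have hx : q (s x) = x := LinearMap.congr_fun hs x
  conv_rhs => rw [LinearMap.id_apply, ← hx, ← Finset.univ_sum_single (s x)]
  simp only [LinearMap.comp_apply, LinearMap.coe_mk, AddHom.coe_mk, LinearMap.sum_apply,
    LinearMap.proj_apply, LinearMap.toSpanSingleton_apply, map_sum, ← map_smul]
  refine Finset.sum_congr rfl fun i _ => ?_
  rw [← Pi.single_smul, smul_eq_mul, mul_one]

/-- The images under `q` of the standard basis and the coordinate functionals `v i` form a dual
basis, as for any finitely generated projective module. -/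
theorem bidualEval_bijective (c : CornerTrace K R S T)
    (P : Type u) [AddCommGroup P] [Module R P] [Module.Finite R P]
    [Module.Projective R P] : Function.Bijective (bidualEval R S T P) := by
  obtain ⟨n, q, hq⟩ := Module.Finite.exists_fin' R P
  obtain ⟨s, hs⟩ := Module.projective_lifting_property q LinearMap.id hq
  have hqs (x : P) : x = ∑ i, s x i • q (Pi.single i 1) := by
    have hx : q (s x) = x := LinearMap.congr_fun hs x
    conv_lhs => rw [← hx, ← Finset.univ_sum_single (s x), map_sum]
    refine Finset.sum_congr rfl fun i _ => ?_
    rw [← map_smul, ← Pi.single_smul, smul_eq_mul, mul_one]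
  let v (i : Fin n) : P →ₗ[R] T := c.equivT.toLinearMap ∘ₗ LinearMap.proj i ∘ₗ s
  constructor
  · rw [← LinearMap.ker_eq_bot, LinearMap.ker_eq_bot']
    intro x hx
    have : ∀ i, s x i = 0 := fun i => c.equivT.injective (by
      simpa [v] using LinearMap.congr_fun hx (v i))
    rw [hqs x]
    simp [this]
  · intro g
    refine ⟨∑ i, c.equivT.symm (g (v i)) • q (Pi.single i 1), LinearMap.ext fun f => ?_⟩
    have hf : f = ∑ i, c.swap.equivT.symm (f (q (Pi.single i 1))) • v i := by
      refine LinearMap.ext fun x => ?_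
      conv_lhs => rw [hqs x, map_sum]
      rw [LinearMap.sum_apply]
      refine Finset.sum_congr rfl fun i _ => ?_
      obtain ⟨a, ha⟩ := c.swap.equivT.surjective (f (q (Pi.single i 1)))
      rw [map_smul, ← ha, LinearEquiv.symm_apply_apply]
      change s x i • a • c.one = a • s x i • c.one
      rw [smul_comm]
    rw [bidualEval_apply, map_sum]
    conv_rhs => rw [hf, map_sum]
    refine Finset.sum_congr rfl fun i _ => ?_
    rw [map_smul, map_smul]
    obtain ⟨a, ha⟩ := c.swap.equivT.surjective (f (q (Pi.single i 1)))
    obtain ⟨b, hb⟩ := c.equivT.surjective (g (v i))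
    rw [← ha, ← hb, LinearEquiv.symm_apply_apply, LinearEquiv.symm_apply_apply]
    change b • a • c.one = a • b • c.one
    rw [smul_comm]

/-- The higher `Ext` groups of the transpose vanish if and only if `M` is reflexive and the higher
`Ext` groups of `Hom_R(M, T)` vanish. -/
theorem extVanishes_transpose_iff (c : CornerTrace K R S T)
    [IsNoetherianRing R] {M : Type u} [AddCommGroup M] [Module R M]
    [Module.Finite R M] (X : MinimalProjectivePresentation R M) :
    ExtVanishes S (X.Transpose S T) T ↔
      Function.Bijective (bidualEval R S T M) ∧ ExtVanishes S (M →ₗ[R] T) T := by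
  have := X.projective₀
  have := X.projective₁
  have h₀ : Module.Finite R X.P₀ := .of_superfluous_ker X.π X.π_surjective X.superfluous₀
  have h₁ : Module.Finite R X.P₁ := by
    refine .of_superfluous_ker X.d.rangeRestrict X.d.surjective_rangeRestrict ?_
    rw [LinearMap.ker_rangeRestrict]
    exact X.superfluous₁
  have := c.projective_hom X.P₀
  have := c.projective_hom X.P₁
  obtain ⟨hinj₀, hsurj₀⟩ := c.bidualEval_bijective X.P₀
  obtain ⟨-, hsurj₁⟩ := c.bidualEval_bijective X.P₁
  have hd : ∀ (f : X.P₀ →ₗ[R] T) (q : X.P₁), X.dualMap S T f q = f (X.d q) := fun _ _ => rfl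
  have hex : Function.Exact (homPrecomp R S T X.π) (X.dualMap S T).rangeRestrict := by
    intro f
    constructor
    · intro hf
      have hf : X.dualMap S T f = 0 := congrArg Subtype.val hf
      have hker : LinearMap.ker X.π ≤ LinearMap.ker f := by
        intro p hp
        obtain ⟨q, rfl⟩ := (X.exact p).1 hp
        exact LinearMap.congr_fun hf q
      let g := (LinearMap.ker X.π).liftQ f hker ∘ₗ
        (X.π.quotKerEquivOfSurjective X.π_surjective).symm.toLinearMap
      refine ⟨g, LinearMap.ext fun p => ?_⟩
      have : (X.π.quotKerEquivOfSurjective X.π_surjective).symm (X.π p) =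
          (LinearMap.ker X.π).mkQ p := by
        rw [LinearEquiv.symm_apply_eq]
        rfl
      change (LinearMap.ker X.π).liftQ f hker
        ((X.π.quotKerEquivOfSurjective X.π_surjective).symm (X.π p)) = f p
      rw [this]
      simp
    · rintro ⟨g, rfl⟩
      refine Subtype.ext (LinearMap.ext fun q => ?_)
      change g (X.π (X.d q)) = 0
      rw [X.exact.apply_apply_eq_zero, map_zero]
  -- Shift along `0 → im → P₁^* → Tr → 0` and `0 → M^* → P₀^* → im → 0`. Besides vanishing of
  -- `Ext(M^*, T)`, two extension conditions remain: over `P₁^*` it is injectivity of evaluation at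
  -- `M`, over `P₀^*` its surjectivity.
  rw [extVanishes_iff_of_exact (i := (LinearMap.range (X.dualMap S T)).subtype)
      (p := (LinearMap.range (X.dualMap S T)).mkQ) Subtype.val_injective
      (Submodule.mkQ_surjective _) (LinearMap.exact_subtype_mkQ _),
    extVanishes_iff_of_exact (i := homPrecomp R S T X.π) (p := (X.dualMap S T).rangeRestrict)
      (fun f g h => LinearMap.ext fun m => by
        obtain ⟨p, rfl⟩ := X.π_surjective m
        exact LinearMap.congr_fun h p)
      (LinearMap.surjective_rangeRestrict _) hex, ← and_assoc]
  refine and_congr_left fun _ => ?_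
  constructor
  · rintro ⟨hΩ, hM⟩
    constructor
    · rw [← LinearMap.ker_eq_bot, LinearMap.ker_eq_bot']
      intro m hm
      obtain ⟨p, rfl⟩ := X.π_surjective m
      -- Evaluation at `p` vanishes on `M^*`, so it factors through the image in `P₁^*`. Its
      -- extension to `P₁^*` is evaluation at some `q`, whence `p = d q` dies in `M`.
      have hker : LinearMap.ker (X.dualMap S T) ≤ LinearMap.ker (bidualEval R S T X.P₀ p) := by
        intro f hf
        obtain ⟨g, rfl⟩ := (hex f).1 (Subtype.ext hf)
        exact LinearMap.congr_fun hm g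
      obtain ⟨g, hg⟩ := hΩ ((LinearMap.ker (X.dualMap S T)).liftQ _ hker ∘ₗ
        (X.dualMap S T).quotKerEquivRange.symm.toLinearMap)
      obtain ⟨q, rfl⟩ := hsurj₁ g
      have : X.d q = p := hinj₀ (LinearMap.ext fun f => by
        have hf : (X.dualMap S T).quotKerEquivRange.symm ⟨X.dualMap S T f, f, rfl⟩ =
            Submodule.Quotient.mk f := by
          rw [LinearEquiv.symm_apply_eq]
          rfl
        have h := LinearMap.congr_fun hg ⟨X.dualMap S T f, f, rfl⟩
        rw [LinearMap.comp_apply, LinearMap.comp_apply, LinearEquiv.coe_coe, hf,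
          Submodule.liftQ_apply] at h
        exact h)
      rw [← this, X.exact.apply_apply_eq_zero]
    · intro f
      obtain ⟨g, rfl⟩ := hM f
      obtain ⟨p, rfl⟩ := hsurj₀ g
      exact ⟨X.π p, rfl⟩
  · rintro ⟨hinj, hsurj⟩
    constructor
    · intro f
      obtain ⟨p, hp⟩ := hsurj₀ (f ∘ₗ (X.dualMap S T).rangeRestrict)
      have hp : ∀ g, g p = f ((X.dualMap S T).rangeRestrict g) := LinearMap.congr_fun hp
      have hπ : X.π p = 0 := hinj (LinearMap.ext fun g => by
        have := hp (homPrecomp R S T X.π g)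
        rw [hex.apply_apply_eq_zero, map_zero] at this
        rw [map_zero]
        exact this)
      obtain ⟨q, rfl⟩ := (X.exact p).1 hπ
      refine ⟨bidualEval R S T X.P₁ q, LinearMap.ext ?_⟩
      rintro ⟨_, g, rfl⟩
      exact hp g
    · intro f
      obtain ⟨m, rfl⟩ := hsurj f
      obtain ⟨p, rfl⟩ := X.π_surjective m
      exact ⟨bidualEval R S T X.P₀ p, rfl⟩

end CornerTrace

/-! ### Building and shifting minimal injective resolutions. -/

section Resolution

variable {R : Type u} [Ring R]

/-- The minimal injective resolution of the first cosyzygy. -/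
def MinimalInjectiveResolution.shift {M : Type u} [AddCommGroup M] [Module R M]
    (J : MinimalInjectiveResolution R M) :
    MinimalInjectiveResolution R (LinearMap.range (J.d 0)) where
  I n := J.I (n + 1)
  injective n := J.injective (n + 1)
  ι := (LinearMap.range (J.d 0)).subtype
  d n := J.d (n + 1)
  ι_injective := Subtype.val_injective
  exact_zero := by
    rw [LinearMap.exact_iff, Submodule.range_subtype]
    exact (LinearMap.exact_iff.1 (J.exact_succ 0))
  exact_succ n := J.exact_succ (n + 1)
  essential_zero := by
    rw [Submodule.range_subtype]
    exact J.essential_succ 0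
  essential_succ n := J.essential_succ (n + 1)

theorem exists_resolution_of_lt_dominantDimension {M : Type u} [AddCommGroup M] [Module R M] {n : ℕ}
    (h : n < dominantDimension R M) :
    ∃ J : MinimalInjectiveResolution R M, ∀ i ≤ n, Module.Projective R (J.I i) := by
  obtain ⟨_, ⟨m, rfl, J, hJ⟩, hm⟩ := lt_sSup_iff.1 h
  exact ⟨J, fun i hi => hJ i (lt_of_le_of_lt hi (by exact_mod_cast hm))⟩

theorem dominantDimension_eq_top {M : Type u} [AddCommGroup M] [Module R M]
    (J : MinimalInjectiveResolution R M) (hJ : ∀ i, Module.Projective R (J.I i)) :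
    dominantDimension R M = ⊤ := by
  rw [ENat.eq_top_iff_forall_ge]
  exact fun n => le_sSup ⟨n, rfl, J, fun i _ => hJ i⟩

/-- Minimal injective resolutions with projective terms, built step by step within a class of
modules. -/
theorem exists_resolution_of_step (C : ModuleCat.{u} R → Prop)
    (step : ∀ X, C X → ∃ (I Y : ModuleCat.{u} R) (ι : X →ₗ[R] I) (g : I →ₗ[R] Y),
      Module.Injective R I ∧ Module.Projective R I ∧ Function.Injective ι ∧
      Function.Surjective g ∧ Function.Exact ι g ∧
      (∀ N : Submodule R I, N ⊓ LinearMap.range ι = ⊥ → N = ⊥) ∧ C Y)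
    (X : ModuleCat.{u} R) (hX : C X) :
    ∃ J : MinimalInjectiveResolution R X, ∀ i, Module.Projective R (J.I i) := by
  choose I Y ι g hI hP hι hg hιg hess hY using step
  let Z : ℕ → {X // C X} := fun n => Nat.rec ⟨X, hX⟩ (fun _ X => ⟨Y X.1 X.2, hY X.1 X.2⟩) n
  let d (n : ℕ) : I (Z n).1 (Z n).2 →ₗ[R] I (Z (n + 1)).1 (Z (n + 1)).2 :=
    ι (Z (n + 1)).1 (Z (n + 1)).2 ∘ₗ g (Z n).1 (Z n).2
  have hker (n) : LinearMap.ker (d n) = LinearMap.range (ι (Z n).1 (Z n).2) := by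
    rw [LinearMap.ker_comp_of_ker_eq_bot _ (LinearMap.ker_eq_bot.2 (hι _ _))]
    exact LinearMap.exact_iff.1 (hιg _ _)
  have hrange (n) : LinearMap.range (d n) = LinearMap.range (ι (Z (n + 1)).1 (Z (n + 1)).2) := by
    rw [LinearMap.range_comp, LinearMap.range_eq_top.2 (hg _ _), Submodule.map_top]
  exact ⟨{
    I := fun n => I (Z n).1 (Z n).2
    injective := fun n => hI _ _
    ι := ι X hX
    d := d
    ι_injective := hι X hX
    exact_zero := LinearMap.exact_iff.2 (hker 0)
    exact_succ := fun n => LinearMap.exact_iff.2 ((hker (n + 1)).trans (hrange n).symm)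
    essential_zero := hess X hX
    essential_succ := fun n => by
      rw [hrange]
      exact hess _ _ }, fun n => hP _ _⟩

theorem Module.Projective.pi_of_finite {ι : Type u} [Finite ι] {M : ι → Type u}
    [∀ i, AddCommGroup (M i)] [∀ i, Module R (M i)] [∀ i, Module.Projective R (M i)] :
    Module.Projective R (∀ i, M i) := by
  classical
  have := Fintype.ofFinite ι
  exact .of_equiv (DFinsupp.linearEquivFunOnFintype (R := R) (M := M))

end Resolution

/-! ### Infinite dominant dimension through vanishing of `Ext`. -/

namespace CornerTrace

variable {K R S T : Type u} [Field K] [Ring R] [Ring S] [Algebra K R] [Algebra K S]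
    [AddCommGroup T] [Module K T] [Module R T] [Module S T] [IsScalarTower K R T]
    [IsScalarTower K S T] [SMulCommClass R S T] [SMulCommClass S R T]
    [FiniteDimensional K T]
    (c : CornerTrace K R S T)

theorem isCornerDetermined_of_resolution {X : Type u} [AddCommGroup X] [Module R X]
    (J : MinimalInjectiveResolution R X) (h₀ : Module.Projective R (J.I 0))
    (h₁ : Module.Projective R (J.I 1)) : IsCornerDetermined c.e X := by
  have := J.injective
  have hI := c.isCornerDetermined_of_projective_of_injective (J.I 0)
  exact ⟨hI.faithful.of_injective J.ι J.ι_injective, hI.complete.of_exact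
    (c.isCornerDetermined_of_projective_of_injective (J.I 1)).faithful J.ι_injective J.exact_zero⟩

/-- An embedding of `X` in a power of the injective module `T e` extends to `I`, with zero kernel by
essentiality. Terms of a resolution are not assumed finite-dimensional, so dualizing them needs
this. -/
theorem finiteDimensional_of_essential {X I : Type u} [AddCommGroup X] [Module K X] [Module R X]
    [IsScalarTower K R X] [FiniteDimensional K X] [AddCommGroup I] [Module K I] [Module R I]
    [IsScalarTower K R I] (hX : IsCornerFaithful c.e X) {ι : X →ₗ[R] I}
    (hι : Function.Injective ι) (hess : ∀ N : Submodule R I, N ⊓ LinearMap.range ι = ⊥ → N = ⊥) :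
    FiniteDimensional K I := by
  obtain ⟨n, f, hf⟩ := c.exists_embedding hX
  have := c.injective_summand
  have : FiniteDimensional K c.summand :=
    inferInstanceAs (FiniteDimensional K (c.summand.restrictScalars K))
  obtain ⟨g, hg⟩ := (inferInstance : Module.Injective R (ULift.{u} (Fin n) → c.summand)).out ι hι f
  have hker : LinearMap.ker g = ⊥ := by
    refine hess _ ((Submodule.eq_bot_iff _).2 ?_)
    rintro _ ⟨hx, x, rfl⟩
    have hx : f x = 0 := (hg x).symm.trans hx
    rw [hf (hx.trans (map_zero f).symm), map_zero]
  exact Module.Finite.of_injective (g.restrictScalars K)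
    (LinearMap.ker_eq_bot (f := g).1 hker)

/-- With `Y` the first cosyzygy, `0 → D(Y) → D(I 0) → D(X) → 0` has projective middle term. The
`K`-structure on `Y` is part of the conclusion because the resolution is only given over `R`. -/
theorem exists_resolution_shift [FiniteDimensional K S] (hT : IsCornerComplete (c.θ c.e) T)
    {X : Type u} [AddCommGroup X] [Module K X] [Module R X] [IsScalarTower K R X]
    [FiniteDimensional K X] (J : MinimalInjectiveResolution R X)
    (h₀ : Module.Projective R (J.I 0)) :
    ∃ (_ : Module K (LinearMap.range (J.d 0))) (_ : IsScalarTower K R (LinearMap.range (J.d 0))),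
      FiniteDimensional K (LinearMap.range (J.d 0)) ∧
      (Subsingleton (Abelian.Ext.{u} (ModuleCat.of S (DualModule c.θ X)) (ModuleCat.of S T) 1) ↔
        IsCornerComplete c.e (LinearMap.range (J.d 0))) ∧
      ∀ n, Subsingleton (Abelian.Ext.{u} (ModuleCat.of S (DualModule c.θ X)) (ModuleCat.of S T)
          (n + 2)) ↔
        Subsingleton (Abelian.Ext.{u} (ModuleCat.of S (DualModule c.θ (LinearMap.range (J.d 0))))
          (ModuleCat.of S T) (n + 1)) := by
  let _ : Module K (J.I 0) := Module.compHom _ (algebraMap K R)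
  let _ : Module K (J.I 1) := Module.compHom _ (algebraMap K R)
  have : IsScalarTower K R (J.I 0) := .of_algebraMap_smul fun _ _ => rfl
  have : IsScalarTower K R (J.I 1) := .of_algebraMap_smul fun _ _ => rfl
  have := J.injective 0
  have hI := c.isCornerDetermined_of_projective_of_injective (J.I 0)
  have : FiniteDimensional K (J.I 0) := c.finiteDimensional_of_essential
    (hI.faithful.of_injective J.ι J.ι_injective) J.ι_injective J.essential_zero
  have hsurj := (J.d 0).surjective_rangeRestrict
  have : FiniteDimensional K (LinearMap.range (J.d 0)) :=
    Module.Finite.of_surjective ((J.d 0).rangeRestrict.restrictScalars K) hsurj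
  have hex : Function.Exact J.ι (J.d 0).rangeRestrict := by
    rw [LinearMap.exact_iff, LinearMap.ker_rangeRestrict]
    exact LinearMap.exact_iff.1 J.exact_zero
  have : Module.Projective S (DualModule c.θ (J.I 0)) := DualModule.projective_of_injective
  refine ⟨inferInstance, inferInstance, inferInstance, ?_, fun n => ?_⟩
  · rw [subsingleton_ext_one_iff (DualModule.map_injective hsurj)
      (DualModule.map_surjective J.ι_injective) (DualModule.map_exact hsurj hex),
      c.forall_exists_extension_iff hT hI.complete hsurj]
  · exact subsingleton_ext_succ_iff (DualModule.map_injective hsurj)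
      (DualModule.map_surjective J.ι_injective) (DualModule.map_exact hsurj hex) n

/-- Shifting `n` times reduces to `Ext^1`. There the next cosyzygy must be complete, which costs two
further projective terms; hence the bound `n + 2`. -/
theorem subsingleton_ext_dual_of_resolution [FiniteDimensional K S]
    (hT : IsCornerComplete (c.θ c.e) T) (n : ℕ) :
    ∀ (X : Type u) [AddCommGroup X] [Module K X] [Module R X] [IsScalarTower K R X]
      [FiniteDimensional K X] (J : MinimalInjectiveResolution R X),
      (∀ i ≤ n + 2, Module.Projective R (J.I i)) →
      Subsingleton (Abelian.Ext.{u} (ModuleCat.of S (DualModule c.θ X)) (ModuleCat.of S T)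
        (n + 1)) := by
  induction n with
  | zero =>
    intro X _ _ _ _ _ J hJ
    obtain ⟨_, _, _, h, -⟩ := c.exists_resolution_shift hT J (hJ 0 (by lia))
    exact h.2 (c.isCornerDetermined_of_resolution J.shift (hJ 1 (by lia)) (hJ 2 (by lia))).complete
  | succ n ih =>
    intro X _ _ _ _ _ J hJ
    obtain ⟨_, _, _, -, h⟩ := c.exists_resolution_shift hT J (hJ 0 (by lia))
    exact (h n).2 (ih _ J.shift fun i hi => hJ (i + 1) (by lia))

/-- Modules of infinite dominant dimension in terms of the vanishing of `Ext` groups of the dual. -/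
theorem dominantDimension_eq_top_iff [FiniteDimensional K R] [FiniteDimensional K S]
    (hT : IsCornerComplete (c.θ c.e) T)
    (X : Type u) [AddCommGroup X] [Module K X] [Module R X] [IsScalarTower K R X]
    [FiniteDimensional K X] :
    dominantDimension R X = ⊤ ↔
      IsCornerDetermined c.e X ∧ ExtVanishes S (DualModule c.θ X) T := by
  constructor
  · intro h
    have hJ (n : ℕ) := exists_resolution_of_lt_dominantDimension (h ▸ ENat.natCast_lt_top n)
    constructor
    · obtain ⟨J, hJ⟩ := hJ 1
      exact c.isCornerDetermined_of_resolution J (hJ 0 zero_le_one) (hJ 1 le_rfl)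
    · intro n hn
      obtain ⟨n, rfl⟩ := Nat.exists_eq_add_of_le' hn
      obtain ⟨J, hJ⟩ := hJ (n + 2)
      exact c.subsingleton_ext_dual_of_resolution hT n X J hJ
  · intro hX
    let C (X : ModuleCat.{u} R) : Prop := ∃ (_ : Module K X) (_ : IsScalarTower K R X),
      FiniteDimensional K X ∧ IsCornerDetermined c.e X ∧ ExtVanishes S (DualModule c.θ X) T
    suffices H : ∃ J : MinimalInjectiveResolution R X, ∀ i, Module.Projective R (J.I i) from
      let ⟨J, hJ⟩ := H
      dominantDimension_eq_top J hJ
    refine exists_resolution_of_step C ?_ (ModuleCat.of R X)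
      ⟨inferInstance, inferInstance, inferInstance, hX⟩
    rintro X ⟨_, _, _, hdet, hext⟩
    -- The injective hull of `X` is a summand of a power of `T e`, hence projective. Its cokernel
    -- stays in the class `C`: faithful because `X` is complete, complete because `Ext^1` vanishes,
    -- with the higher `Ext` shifted.
    obtain ⟨n, f, hf⟩ := c.exists_embedding hdet.faithful
    have := c.injective_summand
    have := c.projective_summand
    have : FiniteDimensional K c.summand :=
      inferInstanceAs (FiniteDimensional K (c.summand.restrictScalars K))
    have : Module.Projective R (ULift.{u} (Fin n) → c.summand) := .pi_of_finite
    have : IsArtinian R (ULift.{u} (Fin n) → c.summand) := isArtinian_of_tower K inferInstance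
    have : IsNoetherian R (ULift.{u} (Fin n) → c.summand) := isNoetherian_of_tower K inferInstance
    obtain ⟨F, p, hXF, hp, hess⟩ := exists_injectiveHull_le (LinearMap.range f)
    have : Module.Injective R F := .of_retract F.subtype p hp
    have : Module.Projective R F := .of_split F.subtype p (LinearMap.ext hp)
    have : FiniteDimensional K F := inferInstanceAs (FiniteDimensional K (F.restrictScalars K))
    let ι : X →ₗ[R] F := f.codRestrict F fun x => hXF ⟨x, rfl⟩
    have hι : Function.Injective ι := fun x y h => hf (congrArg Subtype.val h)
    have hrange : LinearMap.range ι = (LinearMap.range f).submoduleOf F := by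
      ext y
      constructor
      · rintro ⟨x, rfl⟩
        exact ⟨x, rfl⟩
      · rintro ⟨x, hx⟩
        exact ⟨x, Subtype.ext hx⟩
    have hex : Function.Exact ι (LinearMap.range ι).mkQ := LinearMap.exact_map_mkQ_range ι
    have hsurj := Submodule.mkQ_surjective (LinearMap.range ι)
    have : FiniteDimensional K (F ⧸ LinearMap.range ι) :=
      Module.Finite.of_surjective ((LinearMap.range ι).mkQ.restrictScalars K) hsurj
    have hF := c.isCornerDetermined_of_projective_of_injective F
    have : Module.Projective S (DualModule c.θ F) := DualModule.projective_of_injective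
    rw [extVanishes_iff_of_exact (DualModule.map_injective hsurj) (DualModule.map_surjective hι)
      (DualModule.map_exact hsurj hex), c.forall_exists_extension_iff hT hF.complete hsurj] at hext
    exact ⟨ModuleCat.of R F, ModuleCat.of R (F ⧸ LinearMap.range ι), ι, (LinearMap.range ι).mkQ,
      ‹_›, ‹_›, hι, hsurj, hex, hrange ▸ hess, inferInstance, inferInstance, ‹_›,
      ⟨.of_exact c.idem hdet.complete hF.faithful hι hsurj hex, hext.1⟩, hext.2⟩

end CornerTrace

/-- Isomorphic modules have isomorphic duals `Hom_R(-, T)`. -/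
def homCongr (R S T : Type u) [Ring R] [Ring S] [AddCommGroup T] [Module R T] [Module S T]
    [SMulCommClass R S T] {X Y : Type u} [AddCommGroup X] [Module R X]
    [AddCommGroup Y] [Module R Y] (f : X ≃ₗ[R] Y) : (X →ₗ[R] T) ≃ₗ[S] (Y →ₗ[R] T) :=
  .ofLinearMap (homPrecomp R S T f.symm.toLinearMap) (homPrecomp R S T f.toLinearMap)
    (LinearMap.ext fun g => LinearMap.ext fun y => congrArg g (f.apply_symm_apply y))
    (LinearMap.ext fun g => LinearMap.ext fun x => congrArg g (f.symm_apply_apply x))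

/-- Isomorphic modules have isomorphic `K`-duals. -/
def DualModule.congr {K R S : Type u} [Field K] [Ring R] [Ring S] [Algebra K R] [Algebra K S]
    (θ : AntiEquiv K R S) {X Y : Type u} [AddCommGroup X] [Module K X] [AddCommGroup Y] [Module K Y]
    [Module R X] [IsScalarTower K R X] [Module R Y] [IsScalarTower K R Y] (f : X ≃ₗ[R] Y) :
    DualModule θ X ≃ₗ[S] DualModule θ Y :=
  .ofLinearMap (map θ f.symm.toLinearMap) (map θ f.toLinearMap)
    (LinearMap.ext fun μ => DualModule.ext fun y => congrArg μ (f.apply_symm_apply y))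
    (LinearMap.ext fun μ => DualModule.ext fun x => congrArg μ (f.symm_apply_apply x))

/-! ### The equivalence for a module and its dual. -/

namespace CornerTrace

variable {K R S T : Type u} [Field K] [Ring R] [Ring S] [Algebra K R] [Algebra K S]
    [AddCommGroup T] [Module K T] [Module R T] [Module S T] [IsScalarTower K R T]
    [IsScalarTower K S T] [SMulCommClass R S T] [SMulCommClass S R T]
    [FiniteDimensional K R] [FiniteDimensional K S] [FiniteDimensional K T]
    (c : CornerTrace K R S T)
    {M N : Type u} [AddCommGroup M] [Module K M] [Module R M] [IsScalarTower K R M]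
    [FiniteDimensional K M] [AddCommGroup N] [Module K N] [Module S N] [IsScalarTower K S N]
    [FiniteDimensional K N]

theorem exists_extVanishes_transpose_iff (c : CornerTrace K R S T) :
    (∃ X : MinimalProjectivePresentation R M, ExtVanishes S (X.Transpose S T) T) ↔
      Function.Bijective (bidualEval R S T M) ∧ ExtVanishes S (M →ₗ[R] T) T := by
  have : IsNoetherianRing R := isNoetherian_of_tower K inferInstance
  have : IsArtinianRing R := isArtinian_of_tower K inferInstance
  have : Module.Finite R M := .of_restrictScalars_finite K R M
  constructor
  · rintro ⟨X, hX⟩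
    exact (c.extVanishes_transpose_iff X).1 hX
  · obtain ⟨X⟩ := exists_minimalProjectivePresentation (R := R) M
    exact fun h => ⟨X, (c.extVanishes_transpose_iff X).2 h⟩

theorem isCornerDetermined_of_bidualEval_bijective (hT : IsCornerComplete c.e T)
    (h : Function.Bijective (bidualEval R S T M)) : IsCornerDetermined c.e M :=
  (IsCornerDetermined.hom ⟨c.faithful, hT⟩).of_linearEquiv (LinearEquiv.ofBijective _ h)

/-- The double centralizer condition gives `N ≅ Hom_R(D(N), T)`, and `D(N) ≅ M`. -/
theorem nonempty_equiv_hom (hT : IsCornerComplete c.e T)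
    (hN : IsCornerDetermined (c.θ c.e) N) (b : M ≃ₗ[R] DualModule c.θ.symm N) :
    Nonempty (N ≃ₗ[S] (M →ₗ[R] T)) := by
  obtain ⟨f⟩ := c.swap.nonempty_equiv_hom_dual (Y := N) (by simpa [swap] using hT) hN
  exact ⟨f.trans (homCongr R S T b.symm)⟩

theorem bidualEval_bijective_of_isCornerDetermined (hT : IsCornerComplete c.e T)
    (hT' : IsCornerComplete (c.θ c.e) T) (hM : IsCornerDetermined c.e M)
    (hN : IsCornerDetermined (c.θ c.e) N) (a : N ≃ₗ[S] DualModule c.θ M)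
    (b : M ≃ₗ[R] DualModule c.θ.symm N) : Function.Bijective (bidualEval R S T M) := by
  obtain ⟨f⟩ := c.nonempty_equiv_hom hT hN b
  obtain ⟨g⟩ := c.nonempty_equiv_hom_dual hT' hM
  -- This isomorphism need not be evaluation. It only serves to turn the injective evaluation map
  -- into an injective endomorphism of `M`, which is onto by finite dimension.
  let h : M ≃ₗ[R] ((M →ₗ[R] T) →ₗ[S] T) := g.trans (homCongr S R T (a.symm.trans f))
  have hinj : Function.Injective (bidualEval R S T M) := by
    obtain ⟨n, j, hj⟩ := c.exists_embedding hM.faithful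
    rw [← LinearMap.ker_eq_bot, LinearMap.ker_eq_bot']
    intro x hx
    refine hj (funext fun i => Subtype.ext ?_)
    have := LinearMap.congr_fun hx (c.summand.subtype ∘ₗ LinearMap.proj i ∘ₗ j)
    simpa using this
  refine ⟨hinj, fun y => ?_⟩
  have hsurj := (LinearMap.injective_iff_surjective (f := (h.symm.toLinearMap ∘ₗ
    bidualEval R S T M).restrictScalars K)).1 (h.symm.injective.comp hinj)
  obtain ⟨x, hx⟩ := hsurj (h.symm y)
  exact ⟨x, h.symm.injective hx⟩

/-- For a module `M` over `R` with dual `N` over `S`, both are Gorenstein projective if and only if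
both have infinite dominant dimension. -/
theorem gorensteinProjective_iff (hT : IsCornerComplete c.e T)
    (a : N ≃ₗ[S] DualModule c.θ M) (b : M ≃ₗ[R] DualModule c.θ.symm N) :
    ((ExtVanishes R M T ∧
        ∃ X : MinimalProjectivePresentation R M, ExtVanishes S (X.Transpose S T) T) ∧
      ExtVanishes S N T ∧
        ∃ X : MinimalProjectivePresentation S N, ExtVanishes R (X.Transpose R T) T) ↔
      dominantDimension R M = ⊤ ∧ dominantDimension S N = ⊤ := by
  have hT' := c.isCornerComplete_op hT
  have hTs : IsCornerComplete (c.swap.θ c.swap.e) T := by simpa [swap] using hT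
  rw [c.exists_extVanishes_transpose_iff, c.swap.exists_extVanishes_transpose_iff,
    c.dominantDimension_eq_top_iff hT', c.swap.dominantDimension_eq_top_iff hTs]
  constructor
  · rintro ⟨⟨h₁, h₂, -⟩, h₃, h₄, -⟩
    exact ⟨⟨c.isCornerDetermined_of_bidualEval_bijective hT h₂, h₃.of_linearEquiv a⟩,
      c.swap.isCornerDetermined_of_bidualEval_bijective hT' h₄, h₁.of_linearEquiv b⟩
  · rintro ⟨⟨hM, h₁⟩, hN, h₂⟩
    have hM' : IsCornerDetermined (c.swap.θ c.swap.e) M := by simpa [swap] using hM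
    have h₁ := h₁.of_linearEquiv a.symm
    have h₂ := h₂.of_linearEquiv b.symm
    obtain ⟨f⟩ := c.nonempty_equiv_hom hT hN b
    obtain ⟨g⟩ := c.swap.nonempty_equiv_hom hT' hM' a
    exact ⟨⟨h₂, c.bidualEval_bijective_of_isCornerDetermined hT hT' hM hN a b,
      h₁.of_linearEquiv f⟩, h₁,
      c.swap.bidualEval_bijective_of_isCornerDetermined hT' hTs hN hM' b a, h₂.of_linearEquiv g⟩

end CornerTrace

/-! ### The trace form of a gendo-symmetric algebra. -/

section GendoSymmetric

variable {K A : Type u} [Field K] [Ring A] [Algebra K A]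

/-- The anti-isomorphism between an algebra and its opposite. -/
def unopAntiEquiv (K A : Type u) [Field K] [Ring A] [Algebra K A] : AntiEquiv K Aᵐᵒᵖ A where
  toLinearEquiv := (opLinearEquiv K).symm
  map_mul_rev _ _ := rfl

@[simp] theorem unopAntiEquiv_apply (a : Aᵐᵒᵖ) : unopAntiEquiv K A a = unop a := rfl

theorem mem_leftIdeal_iff {e : A} (he : IsIdempotentElem e) {x : A} :
    x ∈ leftIdeal e ↔ x * e = x := by
  rw [Submodule.mem_span_singleton]
  constructor
  · rintro ⟨a, rfl⟩
    rw [smul_eq_mul, mul_assoc, he.eq]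
  · exact fun h => ⟨x, h⟩

theorem mem_rightIdeal_iff {e : A} (he : IsIdempotentElem e) {x : A} :
    x ∈ rightIdeal e ↔ e * x = x := by
  rw [Submodule.mem_span_singleton]
  constructor
  · rintro ⟨a, rfl⟩
    rw [MulOpposite.smul_eq_mul_unop, ← mul_assoc, he.eq]
  · exact fun h => ⟨op x, h⟩

/-- The trace form `e A e → K`, extended to `A`, that corresponds to `e` under `D(A e) ≅ e A`. -/
noncomputable def DualBimoduleIso.trace {e : A} (ι : DualBimoduleIso K e) : A →ₗ[K] K :=
  ι.toEquiv.symm ⟨e, Submodule.mem_span_singleton_self e⟩ ∘ₗ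
    { toFun := fun a => ⟨a * e, Submodule.mem_span_singleton.2 ⟨a, rfl⟩⟩
      map_add' := fun a b => Subtype.ext (add_mul a b e)
      map_smul' := fun k a => Subtype.ext (smul_mul_assoc k a e) }

/-- Since `e` generates `e A`, right linearity determines the isomorphism by the functional that
corresponds to `e`. -/
theorem DualBimoduleIso.symm_apply {e : A} (he : IsIdempotentElem e) (ι : DualBimoduleIso K e)
    (x : rightIdeal e) (y : leftIdeal e) : ι.toEquiv.symm x y = ι.trace (x * y) := by
  have hx : x = ι.toEquiv (ι.toEquiv.symm ⟨e, Submodule.mem_span_singleton_self e⟩ ∘ₗ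
      Algebra.lsmul K K (leftIdeal e) (x : A)) := Subtype.ext (by
    rw [ι.map_right, LinearEquiv.apply_symm_apply, (mem_rightIdeal_iff he).1 x.2])
  conv_lhs => rw [hx, LinearEquiv.symm_apply_apply]
  refine congrArg (ι.toEquiv.symm ⟨e, Submodule.mem_span_singleton_self e⟩) (Subtype.ext ?_)
  change (x : A) * y = x * y * e
  rw [mul_assoc, (mem_leftIdeal_iff he).1 y.2]

/-- The element `e b e` arises from `e` by the right action and by the left action of `e A e`;
comparing the two functionals gives the symmetry. -/
theorem DualBimoduleIso.trace_comm {e : A} (he : IsIdempotentElem e) (ι : DualBimoduleIso K e)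
    (y : leftIdeal e) (b : A) : ι.trace (y * (e * b * e)) = ι.trace (e * b * e * y) := by
  have hmem : e * b * e ∈ rightIdeal e := (mem_rightIdeal_iff he).2 (by
    rw [← mul_assoc, ← mul_assoc, he.eq])
  have hx : (⟨e * b * e, hmem⟩ : rightIdeal e) =
      ι.toEquiv (ι.toEquiv.symm ⟨e, Submodule.mem_span_singleton_self e⟩ ∘ₗ
        mulRightCorner K e b) := Subtype.ext (by
    rw [ι.map_left, LinearEquiv.apply_symm_apply]
    change e * b * e = e * b * e * e
    rw [mul_assoc _ e e, he.eq])
  rw [← ι.symm_apply he ⟨e * b * e, hmem⟩ y, hx, LinearEquiv.symm_apply_apply]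
  refine congrArg (ι.toEquiv.symm ⟨e, Submodule.mem_span_singleton_self e⟩) (Subtype.ext ?_)
  change (y : A) * (e * b * e) * e = y * (e * b * e)
  rw [mul_assoc, mul_assoc _ e e, he.eq]

/-- The trace form of a gendo-symmetric algebra. -/
noncomputable def cornerTraceOfIso [FiniteDimensional K A] {e : A}
    (he : IsMinimalFaithfulProjInj e) (ι : DualBimoduleIso K e) : CornerTrace K Aᵐᵒᵖ A A where
  -- With `R = Aᵐᵒᵖ` the corner `e` acts on `A` by right multiplication and `θ e` by left
  -- multiplication. Thus `T e` is the right ideal `e A`, and `e R` corresponds to the left ideal `A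
  -- e`.
  θ := unopAntiEquiv K A
  one := 1
  smul_one r := by simp [MulOpposite.smul_eq_mul_unop]
  bijective_smul_one := by
    convert (unop_bijective (α := A)) using 2 with r
    simp [MulOpposite.smul_eq_mul_unop]
  e := op e
  idem := by rw [← op_mul, he.idempotent.eq]
  τ := ι.trace
  trace r t := by
    have hy : e * t * e ∈ leftIdeal e := (mem_leftIdeal_iff he.idempotent).2 (by
      rw [mul_assoc, he.idempotent.eq])
    have := ι.trace_comm he.idempotent ⟨_, hy⟩ (unop r)
    have hee (x : A) : e * (e * x) = e * x := by rw [← mul_assoc, he.idempotent.eq]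
    simpa [MulOpposite.smul_eq_mul_unop, mul_assoc, hee] using this
  rep F := by
    let x := ι.toEquiv (F ∘ₗ (opLinearEquiv K).toLinearMap ∘ₗ
      (leftIdeal e).subtype.restrictScalars K)
    refine ⟨x, (mem_rightIdeal_iff he.idempotent).1 x.2, fun r => ?_⟩
    have h := ι.symm_apply he.idempotent x
      ⟨unop r * e, Submodule.mem_span_singleton.2 ⟨unop r, rfl⟩⟩
    rw [LinearEquiv.symm_apply_apply] at h
    simp only [MulOpposite.smul_eq_mul_unop, unop_op, mul_assoc]
    exact h.symm
  sep t ht := by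
    have hx : e * t ∈ rightIdeal e := Submodule.mem_span_singleton.2 ⟨op t, rfl⟩
    have : ι.toEquiv.symm ⟨e * t, hx⟩ = 0 := by
      ext ⟨y, hy⟩
      rw [ι.symm_apply he.idempotent]
      have := ht (op y)
      simpa [MulOpposite.smul_eq_mul_unop, mul_assoc, (mem_leftIdeal_iff he.idempotent).1 hy]
        using this
    rw [LinearEquiv.map_eq_zero_iff] at this
    exact congrArg Subtype.val this
  rep_op F := by
    let G : Module.Dual K (Module.Dual K (leftIdeal e)) :=
      F ∘ₗ (rightIdeal e).subtype.restrictScalars K ∘ₗ ι.toEquiv.toLinearMap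
    let y := (Module.evalEquiv K (leftIdeal e)).symm G
    refine ⟨y, (mem_leftIdeal_iff he.idempotent).1 y.2, fun s => ?_⟩
    have hx : e * s ∈ rightIdeal e := Submodule.mem_span_singleton.2 ⟨op s, rfl⟩
    have h := ι.symm_apply he.idempotent ⟨e * s, hx⟩ y
    have h' : ι.toEquiv.symm ⟨e * s, hx⟩ y = G (ι.toEquiv.symm ⟨e * s, hx⟩) :=
      Module.apply_evalEquiv_symm_apply (R := K) (M := leftIdeal e) _ G
    rw [h'] at h
    simp only [G, LinearMap.comp_apply, LinearEquiv.coe_coe, LinearEquiv.apply_symm_apply] at h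
    simp only [unopAntiEquiv_apply, unop_op, smul_eq_mul, ← mul_assoc]
    exact h.symm
  sep_op t ht := by
    let y : leftIdeal e := ⟨t * e, Submodule.mem_span_singleton.2 ⟨t, rfl⟩⟩
    have : y = 0 := by
      refine (Module.forall_dual_apply_eq_zero_iff K y).1 fun f => ?_
      rw [← ι.toEquiv.symm_apply_apply f, ι.symm_apply he.idempotent]
      have := ht (ι.toEquiv f)
      simp only [unopAntiEquiv_apply, unop_op, smul_eq_mul, ← mul_assoc,
        (mem_rightIdeal_iff he.idempotent).1 (ι.toEquiv f).2] at this
      exact this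
    exact congrArg Subtype.val this
  faithful t ht := by
    have := he.faithful
    refine op_injective (FaithfulSMul.eq_of_smul_eq_smul (α := rightIdeal e) fun x => ?_)
    obtain ⟨f, rfl⟩ := ι.toEquiv.surjective x
    -- If `t A e = 0`, then `t` annihilates `D(A e) ≅ e A`, which is faithful.
    have hf : f ∘ₗ Algebra.lsmul K K (leftIdeal e) t = 0 := by
      ext ⟨y, hy⟩
      have h := ht (op y)
      have : (t • (⟨y, hy⟩ : leftIdeal e)) = 0 := Subtype.ext (by
        simpa [MulOpposite.smul_eq_mul_unop, mul_assoc,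
          (mem_leftIdeal_iff he.idempotent).1 hy] using h)
      change f (t • ⟨y, hy⟩) = 0
      rw [this, map_zero]
    have h := ι.map_right f t
    rw [hf, map_zero] at h
    refine Subtype.ext ?_
    change (ι.toEquiv f : A) * t = ι.toEquiv f * 0
    rw [← h, mul_zero]
    rfl
  faithful_op t ht := by
    have := he.faithful
    refine op_injective (FaithfulSMul.eq_of_smul_eq_smul (α := rightIdeal e) fun x => ?_)
    refine Subtype.ext ?_
    change (x : A) * t = x * 0
    have := ht x
    simp only [unopAntiEquiv_apply, unop_op, smul_eq_mul, ← mul_assoc,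
      (mem_rightIdeal_iff he.idempotent).1 x.2] at this
    rw [this, mul_zero]

variable (K A) in
/-- A gendo-symmetric algebra has a trace form with the double centralizer property. -/
theorem IsGendoSymmetric.exists_cornerTrace [FiniteDimensional K A] (hA : IsGendoSymmetric K A) :
    ∃ c : CornerTrace K Aᵐᵒᵖ A A, c.θ = unopAntiEquiv K A ∧ IsCornerComplete c.e A := by
  obtain ⟨e, he, ⟨ι⟩⟩ := hA.exists_iso
  obtain ⟨J, hJ⟩ := exists_resolution_of_lt_dominantDimension (R := Aᵐᵒᵖ) (M := A) (n := 1)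
    (lt_of_lt_of_le (by norm_num) hA.two_le_dominantDimension)
  exact ⟨cornerTraceOfIso he ι, rfl, ((cornerTraceOfIso he ι).isCornerDetermined_of_resolution J
    (hJ 0 zero_le_one) (hJ 1 le_rfl)).complete⟩

variable (K A) (M : Type u) [AddCommGroup M] [Module K M] [Module Aᵐᵒᵖ M] [IsScalarTower K Aᵐᵒᵖ M]

instance : Module K (KDual K A M) := inferInstanceAs (Module K (M →ₗ[K] K))

instance [FiniteDimensional K M] : FiniteDimensional K (KDual K A M) :=
  inferInstanceAs (FiniteDimensional K (M →ₗ[K] K))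

/-- The left module `D(M)` is the dual over the opposite algebra. -/
def kDualEquiv : KDual K A M ≃ₗ[A] DualModule (unopAntiEquiv K A) M where
  __ := AddEquiv.refl (M →ₗ[K] K)
  map_smul' _ _ := rfl

instance : IsScalarTower K A (KDual K A M) :=
  inferInstanceAs (IsScalarTower K A (DualModule (unopAntiEquiv K A) M))

end GendoSymmetric

theorem theorem4 (K A : Type u) [Field K] [Ring A] [Algebra K A] [FiniteDimensional K A]
    (hA : IsGendoSymmetric K A)
    (M : Type u) [AddCommGroup M] [Module K M] [Module Aᵐᵒᵖ M] [IsScalarTower K Aᵐᵒᵖ M]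
    [FiniteDimensional K M] :
    IsGorensteinProjectiveInjective K A M ↔
      dominantDimension Aᵐᵒᵖ M = ⊤ ∧ codominantDimension K A M = ⊤ := by
  obtain ⟨c, hc, hT⟩ := hA.exists_cornerTrace
  have : FiniteDimensional K Aᵐᵒᵖ := Module.Finite.equiv (opLinearEquiv K)
  have a : KDual K A M ≃ₗ[A] DualModule c.θ M := hc ▸ kDualEquiv K A M
  exact c.gorensteinProjective_iff hT a
    ((DualModule.evalEquiv c.θ M).trans (DualModule.congr c.θ.symm a.symm))
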